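/- Let $A$ and $B$ be finite alphabets and let $F_1\subseteq A^*$, $F_2\subseteq B^*$ be arbitrary languages ("filters"). For a filter $F$ let $\mathrm{NRR}(F)$ be the set of (encodings of) all nondeterministic finite automata $\mathcal A$, with $\varepsilon$-transitions allowed, over the alphabet of $F$ such that $L(\mathcal A)\cap F\neq\varnothing$. We say that $F_1$ is rationally dominated by $F_2$, written $F_1\le_{\mathrm{rat}}F_2$, if there is a rational relation $R\subseteq B^*\times A^*$ (a rational subset of the monoid $B^*\times A^*$) with $F_1=R(F_2)=\{u\in A^* : \exists v\in F_2,\ (v,u)\in R\}$. A rational transducer $T$ with input alphabet $B$ and output alphabet $A$ is a finite nondeterministic automaton whose transitions read a letter of $B$ or $\varepsilon$ and write a letter of $A$ or $\varepsilon$; $T(F_2)$ is the set of all words that $T$ can write on an accepting path reading some word of $F_2$. If $F_1\le_{\mathrm{rat}}F_2$, then $\mathrm{NRR}(F_1)$ is reducible to $\mathrm{NRR}(F_2)$ by a deterministic log-space many-one reduction. Moreover, there is a rational transducer $T$ with $F_1=T(F_2)$, and for every such $T$ the reduction can be chosen to be composition with $T$: there is a deterministic log-space many-one reduction of $\mathrm{NRR}(F_1)$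 to $\mathrm{NRR}(F_2)$ that maps (the encoding of) each automaton $\mathcal A$ over $A$ to (the encoding of) an automaton $\mathcal B=T\circ\mathcal A$ over $B$, that is, an automaton with $$L(\mathcal B)=\{w\in B^* : \text{there is } y\in L(\mathcal A) \text{ that } T \text{ can output on input } w\}.$$ -/

import Mathlib

open scoped Pointwise

/-! ### Rational relations, rational domination, rational transducers -/

/-- Rational subsets of a monoid: the least family of subsets that contains the finite subsets
and is closed under union, product and the star (generated submonoid). -/
inductive IsRationalSet {M : Type} [Monoid M] : Set M → Prop
  | finite {S : Set M} : S.Finite → IsRationalSet S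
  | union {S T : Set M} : IsRationalSet S → IsRationalSet T → IsRationalSet (S ∪ T)
  | mul {S T : Set M} : IsRationalSet S → IsRationalSet T → IsRationalSet (S * T)
  | star {S : Set M} : IsRationalSet S → IsRationalSet (Submonoid.closure S : Set M)

/-- `R(X) = {u | ∃ v ∈ X, (v, u) ∈ R}` for a relation `R ⊆ B* × A*`. -/
def relImage {A B : Type} (R : Set (FreeMonoid B × FreeMonoid A)) (X : Language B) :
    Language A :=
  {u : List A | ∃ v ∈ X, (FreeMonoid.ofList v, FreeMonoid.ofList u) ∈ R}

/-- `L ⊆ A*` is rationally dominated by `L' ⊆ B*`: `L = R(L')` for some rational relation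
`R ⊆ B* × A*`. -/
def RatDominated {A B : Type} (L : Language A) (L' : Language B) : Prop :=
  ∃ R : Set (FreeMonoid B × FreeMonoid A), IsRationalSet R ∧ L = relImage R L'

/-- A rational transducer with input alphabet `A` and output alphabet `B`; the label `none`
stands for the empty word. -/
structure RationalTransducer (A B : Type) where
  Q : Type
  [finiteQ : Finite Q]
  start : Q
  trans : Set (Q × Option A × Option B × Q)
  accept : Set Q

namespace RationalTransducer

variable {A B : Type}

/-- `T.Run q u v r`: there is a path from `q` to `r` on which `T` reads `u` and writes `v`. -/
inductive Run (T : RationalTransducer A B) : T.Q → List A → List B → T.Q → Prop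
  | nil (q : T.Q) : Run T q [] [] q
  | cons {q q' r : T.Q} {a : Option A} {b : Option B} {u : List A} {v : List B} :
      (q, a, b, q') ∈ T.trans → Run T q' u v r → Run T q (a.toList ++ u) (b.toList ++ v) r

/-- `(u, v)` belongs to the relation of `T`: on input `u` the transducer can write `v` and stop
in an accepting state. -/
def Realizes (T : RationalTransducer A B) (u : List A) (v : List B) : Prop :=
  ∃ r ∈ T.accept, T.Run T.start u v r

/-- `T(X)`, the set of all outputs of `T` on inputs from `X`. -/
def image (T : RationalTransducer A B) (X : Language A) : Language B :=
  {v : List B | ∃ u ∈ X, T.Realizes u v}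

end RationalTransducer

/-! ### Descriptions of nondeterministic finite automata -/

/-- A finite description of an NFA over `A` (with `ε`-transitions, labelled `none`). States are
named by binary words. The description gives the initial state, a list of states, the list of
accepting states and the list of transitions. -/
structure NFADescription (A : Type) where
  init : List Bool
  states : List (List Bool)
  final : List (List Bool)
  trans : List (List Bool × Option A × List Bool)

/-- The symbols used to write down descriptions of NFAs over `A`. -/
inductive NFASymbol (A : Type)
  | bit (b : Bool)
  | init
  | state
  | final
  | edge
  | label (a : Option A)

namespace NFADescription

variable {A : Type}

/-- The finite state set: all the states that occur in the description. -/
def stateSet (𝒜 : NFADescription A) : Finset (List Bool) :=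
  (𝒜.init :: (𝒜.states ++ 𝒜.final ++ 𝒜.trans.flatMap fun t => [t.1, t.2.2])).toFinset

/-- The automaton that is described. -/
def toεNFA (𝒜 : NFADescription A) : εNFA A 𝒜.stateSet where
  step p a := {q | (p.1, a, q.1) ∈ 𝒜.trans}
  start := {p | p.1 = 𝒜.init}
  accept := {p | p.1 ∈ 𝒜.final}

/-- The language `L(𝒜)` recognized by the automaton. -/
def language (𝒜 : NFADescription A) : Language A :=
  𝒜.toεNFA.accepts

/-- The description as a word over the alphabet `NFASymbol A`. -/
def encode (𝒜 : NFADescription A) : List (NFASymbol A) :=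
  (NFASymbol.init :: 𝒜.init.map NFASymbol.bit) ++
    (𝒜.states.flatMap fun p => NFASymbol.state :: p.map NFASymbol.bit) ++
    (𝒜.final.flatMap fun p => NFASymbol.final :: p.map NFASymbol.bit) ++
    (𝒜.trans.flatMap fun t =>
      NFASymbol.edge :: t.1.map NFASymbol.bit ++ NFASymbol.label t.2.1 :: t.2.2.map NFASymbol.bit)

end NFADescription

/-- The regular realizability problem: the set of (the encodings of) all NFAs `𝒜` with
`L(𝒜) ∩ F ≠ ∅`. -/
def NRR {A : Type} (F : Language A) : Language (NFASymbol A) :=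
  {x : List (NFASymbol A) | ∃ 𝒜 : NFADescription A, x = 𝒜.encode ∧
    ∃ u, u ∈ 𝒜.language ∧ u ∈ F}

/-! ### Deterministic log-space computation -/

/-- Head movements. -/
inductive HeadMove
  | left
  | stay
  | right

/-- What the input head can see: an endmarker or an input letter. -/
inductive InputCell (I : Type)
  | leftEnd
  | letter (i : I)
  | rightEnd

/-- One instruction of a machine with `k` work tapes. -/
structure TMAction (Q Γ O : Type) (k : ℕ) where
  state : Q
  inputMove : HeadMove
  write : Fin k → Γ
  workMove : Fin k → HeadMove
  emit : Option O

/-- A deterministic Turing machine with a two-way read-only input tape with endmarkers, finitely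
many one-way infinite work tapes, and a one-way write-only output tape. It halts when the
transition function gives `none`. -/
structure SpaceTM (I O : Type) where
  Q : Type
  [finiteQ : Finite Q]
  Γ : Type
  [finiteΓ : Finite Γ]
  blank : Γ
  tapes : ℕ
  start : Q
  δ : Q → InputCell I → (Fin tapes → Γ) → Option (TMAction Q Γ O tapes)

namespace SpaceTM

variable {I O : Type}

/-- Configurations. The input word `x` occupies the positions `1, …, |x|` of the input tape, the
endmarkers the positions `0` and `|x| + 1`. -/
structure Cfg (M : SpaceTM I O) where
  state : M.Q
  inputHead : ℕ
  work : Fin M.tapes → ℕ → M.Γ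
  workHead : Fin M.tapes → ℕ
  output : List O

/-- The content of position `p` of the input tape. -/
def inputCell (x : List I) : ℕ → InputCell I
  | 0 => .leftEnd
  | p + 1 => match x[p]? with
    | some i => .letter i
    | none => .rightEnd

/-- Movement on a one-way infinite tape; at the left end, a move to the left has no effect. -/
def moveHead : HeadMove → ℕ → ℕ
  | .left, p => p - 1
  | .stay, p => p
  | .right, p => p + 1

/-- The initial configuration. -/
def initCfg (M : SpaceTM I O) : M.Cfg where
  state := M.start
  inputHead := 0
  work := fun _ _ => M.blank
  workHead := fun _ => 0
  output := []

/-- One step on the input word `x`. The input head never leaves the positions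
`0, …, |x| + 1`. -/
def step (M : SpaceTM I O) (x : List I) (c : M.Cfg) : Option M.Cfg :=
  (M.δ c.state (inputCell x c.inputHead) fun i => c.work i (c.workHead i)).map fun a =>
    { state := a.state
      inputHead := min (moveHead a.inputMove c.inputHead) (x.length + 1)
      work := fun i => Function.update (c.work i) (c.workHead i) (a.write i)
      workHead := fun i => moveHead (a.workMove i) (c.workHead i)
      output := c.output ++ a.emit.toList }

/-- `c` occurs in the computation of `M` on `x`. -/
def Reachable (M : SpaceTM I O) (x : List I) (c : M.Cfg) : Prop :=
  StateTransition.Reaches (M.step x) M.initCfg c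

/-- On the input `x` the machine halts with the output `y`. -/
def Outputs (M : SpaceTM I O) (x : List I) (y : List O) : Prop :=
  ∃ c, M.Reachable x c ∧ M.step x c = none ∧ c.output = y

/-- On the input `x` the machine visits only the first `s` cells of each work tape. -/
def UsesSpace (M : SpaceTM I O) (x : List I) (s : ℕ) : Prop :=
  ∀ c, M.Reachable x c → ∀ i, c.workHead i < s

end SpaceTM

/-- `f` is computed by a deterministic machine in space `O(log n)`, `n` being the input length
(the input and output tapes do not count). -/
def LogSpaceComputable {I O : Type} (f : List I → List O) : Prop :=
  ∃ (M : SpaceTM I O) (c : ℕ), ∀ x : List I,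
    M.Outputs x (f x) ∧ M.UsesSpace x (c * (Nat.log 2 x.length + 1))

/-- `f` is a deterministic log-space (many-one) reduction of `L` to `L'`. -/
def IsLogSpaceReduction {I O : Type} (L : Language I) (L' : Language O)
    (f : List I → List O) : Prop :=
  LogSpaceComputable f ∧ ∀ x, x ∈ L ↔ f x ∈ L'

/-- `L` is reducible to `L'` by a deterministic log-space reduction. -/
def LogSpaceReducible {I O : Type} (L : Language I) (L' : Language O) : Prop :=
  ∃ f : List I → List O, IsLogSpaceReduction L L' f

/-! A rational relation is realized by a transducer `T`; this is the easy half of Kleene's theorem,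
by induction on rational expressions (`exists_relation_eq`). The rest is a product construction that
has to be carried out by a very weak machine.

The states of `T ∘ 𝒜` are words `T.code q ++ p`, where `p` is a state of `𝒜` and `q` a state of `T`;
codes of equal length make the pair recoverable. When `T` writes a letter, `𝒜` advances along an
edge with that letter; when `T` writes nothing, `𝒜` waits; on an `ε`-edge of `𝒜`, `T` waits. The
edges of the composition are labelled by what `T` reads, so it accepts `w` iff `T` can turn `w` into
some word of `L(𝒜)` (`mem_language_compose`). With `F₁ = T(F₂)`, an output in `L(𝒜) ∩ F₁` exists iff
the composition accepts an input in `F₂`.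

As `T` is fixed, the encoding of `T ∘ 𝒜` is a concatenation of a bounded number of pieces, each
obtained from the encoding of `𝒜` by replacing every block (a marker with the binary word after it)
according to a rule that sees only the marker. A two-way finite-state machine writes one piece per
sweep and copies binary words directly from the input, so no work tape is needed (`flatMap_rules`,
`outputs_encode`). Since the source of an edge is written before the label is seen, an edge that
does not fit the current move cannot be suppressed; it is redirected to a dead state instead.

A reduction must also behave on words that encode nothing. The shape of an encoding is a regular
property of the sequence of markers, so a preliminary sweep checks it, and non-encodings are sent to
non-encodings (`exists_outputs_of_ne_encode`). -/

/-! ### Rational relations are realized by rational transducers -/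

namespace RationalTransducer

attribute [instance] RationalTransducer.finiteQ

variable {A B : Type}

theorem Run.single {T : RationalTransducer A B} {q q' : T.Q} {a : Option A} {b : Option B}
    (h : (q, a, b, q') ∈ T.trans) : T.Run q a.toList b.toList q' := by
  simpa using Run.cons h (Run.nil q')

theorem Run.epsilon {T : RationalTransducer A B} {q q' r : T.Q} {u : List A} {v : List B}
    (h : (q, none, none, q') ∈ T.trans) (hr : T.Run q' u v r) : T.Run q u v r :=
  Run.cons h hr

theorem Run.append {T : RationalTransducer A B} {q r s : T.Q} {u u' : List A} {v v' : List B}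
    (h : T.Run q u v r) (h' : T.Run r u' v' s) : T.Run q (u ++ u') (v ++ v') s := by
  induction h with
  | nil => exact h'
  | cons ht _ ih => simpa using Run.cons ht (ih h')

theorem Run.map {T T' : RationalTransducer A B} (f : T.Q → T'.Q)
    (hf : ∀ q a b q', (q, a, b, q') ∈ T.trans → (f q, a, b, f q') ∈ T'.trans)
    {q r : T.Q} {u : List A} {v : List B} (h : T.Run q u v r) : T'.Run (f q) u v (f r) := by
  induction h with
  | nil => exact Run.nil _
  | cons ht _ ih => exact Run.cons (hf _ _ _ _ ht) ih

/-- The relation realized by a transducer, as a subset of the product monoid. -/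
def relation (T : RationalTransducer A B) : Set (FreeMonoid A × FreeMonoid B) :=
  {p | T.Realizes p.1.toList p.2.toList}

/-- A transducer without accepting states. -/
def empty : RationalTransducer A B where
  Q := Unit
  start := ()
  trans := ∅
  accept := ∅

theorem relation_empty : (empty : RationalTransducer A B).relation = ∅ := by
  ext p
  exact ⟨fun ⟨_, hr, _⟩ => hr.elim, fun h => h.elim⟩

/-- A transducer with a single transition. -/
abbrev edge (a : Option A) (b : Option B) : RationalTransducer A B where
  Q := Bool
  start := false
  trans := {(false, a, b, true)}
  accept := {true}

theorem relation_edge (a : Option A) (b : Option B) :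
    (edge a b).relation = {(FreeMonoid.ofList a.toList, FreeMonoid.ofList b.toList)} := by
  ext ⟨u, v⟩
  constructor
  · rintro ⟨r, hr, h⟩
    have htrue : ∀ {q r : (edge a b).Q} {u : List A} {v : List B}, (edge a b).Run q u v r →
        q = true → u = [] ∧ v = [] := by
      intro q r u v h hq
      cases h with
      | nil => exact ⟨rfl, rfl⟩
      | cons ht _ =>
        have := (Prod.ext_iff.1 ht).1
        simp_all
    have hrun : ∀ {q r : (edge a b).Q} {u : List A} {v : List B}, (edge a b).Run q u v r →
        q = false → r = true → u = a.toList ∧ v = b.toList := by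
      intro q r u v h hq hr
      cases h with
      | nil => simp_all
      | cons ht h' =>
        obtain ⟨-, rfl, rfl, rfl⟩ : _ = false ∧ _ = a ∧ _ = b ∧ _ = true := by
          simpa [edge] using ht
        obtain ⟨rfl, rfl⟩ := htrue h' rfl
        simp
    obtain ⟨hu, hv⟩ := hrun h rfl hr
    exact Prod.ext hu hv
  · rintro h
    obtain ⟨rfl, rfl⟩ := Prod.ext_iff.1 h
    exact ⟨true, rfl, Run.single rfl⟩

section Union

variable (T₁ T₂ : RationalTransducer A B)

/-- The transitions of the union of two transducers. -/
inductive UnionStep : Option (T₁.Q ⊕ T₂.Q) → Option A → Option B → Option (T₁.Q ⊕ T₂.Q) → Prop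
  | startLeft : UnionStep none none none (some (.inl T₁.start))
  | startRight : UnionStep none none none (some (.inr T₂.start))
  | left {q a b q'} : (q, a, b, q') ∈ T₁.trans → UnionStep (some (.inl q)) a b (some (.inl q'))
  | right {q a b q'} : (q, a, b, q') ∈ T₂.trans → UnionStep (some (.inr q)) a b (some (.inr q'))

/-- The union of two transducers. -/
abbrev union : RationalTransducer A B where
  Q := Option (T₁.Q ⊕ T₂.Q)
  start := none
  trans := {t | UnionStep T₁ T₂ t.1 t.2.1 t.2.2.1 t.2.2.2}
  accept := {x | (∃ q ∈ T₁.accept, x = some (.inl q)) ∨ ∃ q ∈ T₂.accept, x = some (.inr q)}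

variable {T₁ T₂}

/-- No transition enters the fresh start state or crosses between the two summands, so after the
first step a run is a run of one of the transducers. The three possible kinds of `x` are treated at
once to make the induction go through. -/
theorem Run.of_union {x y : (union T₁ T₂).Q} {u : List A} {v : List B}
    (h : (union T₁ T₂).Run x u v y) (hy : y ∈ (union T₁ T₂).accept) :
    (∀ q, x = some (.inl q) → ∃ r ∈ T₁.accept, T₁.Run q u v r) ∧
    (∀ q, x = some (.inr q) → ∃ r ∈ T₂.accept, T₂.Run q u v r) ∧
    (x = none → T₁.Realizes u v ∨ T₂.Realizes u v) := by
  induction h with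
  | nil x =>
    rcases hy with ⟨q, hq, rfl⟩ | ⟨q, hq, rfl⟩
    · refine ⟨fun q' h => ⟨q, hq, ?_⟩, nofun, nofun⟩
      cases h
      exact Run.nil _
    · refine ⟨nofun, fun q' h => ⟨q, hq, ?_⟩, nofun⟩
      cases h
      exact Run.nil _
  | cons ht _ ih =>
    obtain ⟨ih₁, ih₂, ih₃⟩ := ih hy
    cases ht with
    | startLeft => exact ⟨nofun, nofun, fun _ => Or.inl (ih₁ _ rfl)⟩
    | startRight => exact ⟨nofun, nofun, fun _ => Or.inr (ih₂ _ rfl)⟩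
    | left ht =>
      refine ⟨fun q h => ?_, nofun, nofun⟩
      obtain ⟨r, hr, h'⟩ := ih₁ _ rfl
      cases h
      exact ⟨r, hr, Run.cons ht h'⟩
    | right ht =>
      refine ⟨nofun, fun q h => ?_, nofun⟩
      obtain ⟨r, hr, h'⟩ := ih₂ _ rfl
      cases h
      exact ⟨r, hr, Run.cons ht h'⟩

theorem relation_union : (union T₁ T₂).relation = T₁.relation ∪ T₂.relation := by
  ext p
  constructor
  · rintro ⟨y, hy, h⟩
    exact (h.of_union hy).2.2 rfl
  · rintro (⟨r, hr, h⟩ | ⟨r, hr, h⟩)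
    · exact ⟨some (.inl r), Or.inl ⟨r, hr, rfl⟩, Run.epsilon UnionStep.startLeft
        (h.map (T' := union T₁ T₂) (fun q => some (.inl q)) fun _ _ _ _ => UnionStep.left)⟩
    · exact ⟨some (.inr r), Or.inr ⟨r, hr, rfl⟩, Run.epsilon UnionStep.startRight
        (h.map (T' := union T₁ T₂) (fun q => some (.inr q)) fun _ _ _ _ => UnionStep.right)⟩

end Union

section Concat

variable (T₁ T₂ : RationalTransducer A B)

/-- The transitions of the concatenation of two transducers. -/
inductive ConcatStep : T₁.Q ⊕ T₂.Q → Option A → Option B → T₁.Q ⊕ T₂.Q → Prop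
  | left {q a b q'} : (q, a, b, q') ∈ T₁.trans → ConcatStep (.inl q) a b (.inl q')
  | bridge {q} : q ∈ T₁.accept → ConcatStep (.inl q) none none (.inr T₂.start)
  | right {q a b q'} : (q, a, b, q') ∈ T₂.trans → ConcatStep (.inr q) a b (.inr q')

/-- The concatenation of two transducers. -/
abbrev concat : RationalTransducer A B where
  Q := T₁.Q ⊕ T₂.Q
  start := .inl T₁.start
  trans := {t | ConcatStep T₁ T₂ t.1 t.2.1 t.2.2.1 t.2.2.2}
  accept := {x | ∃ q ∈ T₂.accept, x = .inr q}

variable {T₁ T₂}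

/-- The bridge is the only passage from the left summand to the right one and there is no way back,
so an accepting run from the left crosses it exactly once; the words are cut there. -/
theorem Run.of_concat {x y : (concat T₁ T₂).Q} {u : List A} {v : List B}
    (h : (concat T₁ T₂).Run x u v y) (hy : y ∈ (concat T₁ T₂).accept) :
    (∀ q, x = .inl q → ∃ u₁ u₂ v₁ v₂, u = u₁ ++ u₂ ∧ v = v₁ ++ v₂ ∧
      (∃ r ∈ T₁.accept, T₁.Run q u₁ v₁ r) ∧ T₂.Realizes u₂ v₂) ∧
    (∀ q, x = .inr q → ∃ r ∈ T₂.accept, T₂.Run q u v r) := by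
  induction h with
  | nil x =>
    obtain ⟨q, hq, rfl⟩ := hy
    refine ⟨nofun, fun q' h => ⟨q, hq, ?_⟩⟩
    cases h
    exact Run.nil _
  | cons ht _ ih =>
    obtain ⟨ih₁, ih₂⟩ := ih hy
    cases ht with
    | left ht =>
      refine ⟨fun q h => ?_, nofun⟩
      obtain ⟨u₁, u₂, v₁, v₂, rfl, rfl, ⟨r, hr, h₁⟩, h₂⟩ := ih₁ _ rfl
      cases h
      exact ⟨_, u₂, _, v₂, (List.append_assoc ..).symm, (List.append_assoc ..).symm,
        ⟨r, hr, Run.cons ht h₁⟩, h₂⟩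
    | bridge hq =>
      refine ⟨fun q h => ?_, nofun⟩
      cases h
      exact ⟨[], _, [], _, rfl, rfl, ⟨_, hq, Run.nil _⟩, ih₂ _ rfl⟩
    | right ht =>
      refine ⟨nofun, fun q h => ?_⟩
      obtain ⟨r, hr, h'⟩ := ih₂ _ rfl
      cases h
      exact ⟨r, hr, Run.cons ht h'⟩

theorem relation_concat : (concat T₁ T₂).relation = T₁.relation * T₂.relation := by
  ext p
  constructor
  · rintro ⟨y, hy, h⟩
    obtain ⟨u₁, u₂, v₁, v₂, hu, hv, h₁, h₂⟩ := (h.of_concat hy).1 _ rfl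
    exact ⟨(FreeMonoid.ofList u₁, FreeMonoid.ofList v₁), h₁,
      (FreeMonoid.ofList u₂, FreeMonoid.ofList v₂), h₂, Prod.ext hu.symm hv.symm⟩
  · rintro ⟨p₁, ⟨r₁, hr₁, h₁⟩, p₂, ⟨r₂, hr₂, h₂⟩, rfl⟩
    exact ⟨.inr r₂, ⟨r₂, hr₂, rfl⟩,
      (h₁.map (T' := concat T₁ T₂) .inl fun _ _ _ _ => ConcatStep.left).append
      (Run.epsilon (ConcatStep.bridge hr₁)
        (h₂.map (T' := concat T₁ T₂) .inr fun _ _ _ _ => ConcatStep.right))⟩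

end Concat

section Star

variable (T : RationalTransducer A B)

/-- The transitions of the star of a transducer. -/
inductive StarStep : Option T.Q → Option A → Option B → Option T.Q → Prop
  | enter : StarStep none none none (some T.start)
  | inner {q a b q'} : (q, a, b, q') ∈ T.trans → StarStep (some q) a b (some q')
  | leave {q} : q ∈ T.accept → StarStep (some q) none none none

/-- The star of a transducer. -/
abbrev star : RationalTransducer A B where
  Q := Option T.Q
  start := none
  trans := {t | StarStep T t.1 t.2.1 t.2.2.1 t.2.2.2}
  accept := {none}

variable {T}

/-- The fresh state `none` separates the iterations: a run from inside `T` is cut at its first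
return to `none`, and what follows is again a product of elements of the relation. -/
theorem Run.of_star {x y : T.star.Q} {u : List A} {v : List B}
    (h : T.star.Run x u v y) (hy : y = none) :
    (x = none → (FreeMonoid.ofList u, FreeMonoid.ofList v) ∈ Submonoid.closure T.relation) ∧
    (∀ q, x = some q → ∃ u₁ u₂ v₁ v₂, u = u₁ ++ u₂ ∧ v = v₁ ++ v₂ ∧
      (∃ r ∈ T.accept, T.Run q u₁ v₁ r) ∧
      (FreeMonoid.ofList u₂, FreeMonoid.ofList v₂) ∈ Submonoid.closure T.relation) := by
  induction h with
  | nil x =>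
    subst hy
    exact ⟨fun _ => one_mem _, nofun⟩
  | cons ht _ ih =>
    obtain ⟨ih₁, ih₂⟩ := ih hy
    cases ht with
    | enter =>
      refine ⟨fun _ => ?_, nofun⟩
      obtain ⟨u₁, u₂, v₁, v₂, rfl, rfl, h₁, h₂⟩ := ih₂ _ rfl
      exact mul_mem (Submonoid.subset_closure
        (show (FreeMonoid.ofList u₁, FreeMonoid.ofList v₁) ∈ T.relation from h₁)) h₂
    | inner ht =>
      refine ⟨nofun, fun q h => ?_⟩
      obtain ⟨u₁, u₂, v₁, v₂, rfl, rfl, ⟨r, hr, h₁⟩, h₂⟩ := ih₂ _ rfl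
      cases h
      exact ⟨_, u₂, _, v₂, (List.append_assoc ..).symm, (List.append_assoc ..).symm,
        ⟨r, hr, Run.cons ht h₁⟩, h₂⟩
    | leave hq =>
      refine ⟨nofun, fun q h => ?_⟩
      cases h
      exact ⟨[], _, [], _, rfl, rfl, ⟨_, hq, Run.nil _⟩, ih₁ rfl⟩

theorem relation_star : T.star.relation = Submonoid.closure T.relation := by
  ext p
  constructor
  · rintro ⟨y, hy, h⟩
    exact (h.of_star hy).1 rfl
  · intro hp
    refine ⟨none, rfl, ?_⟩
    induction hp using Submonoid.closure_induction with
    | mem p hp =>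
      obtain ⟨r, hr, h⟩ := hp
      have h' := h.map (T' := T.star) some fun _ _ _ _ => StarStep.inner
      simpa using Run.epsilon (T := T.star) StarStep.enter
        (h'.append (Run.single (StarStep.leave hr)))
    | one => exact Run.nil _
    | mul p q _ _ ihp ihq => exact Run.append ihp ihq

end Star

/-- The pair is a product of generators `(a, 1)` and `(1, b)`: all of `u` is read first, then all of
`v` is written. -/
theorem exists_relation_eq_singleton (u : FreeMonoid A) (v : FreeMonoid B) :
    ∃ T : RationalTransducer A B, T.relation = {(u, v)} := by
  induction u using FreeMonoid.inductionOn' with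
  | one =>
    induction v using FreeMonoid.inductionOn' with
    | one => exact ⟨edge none none, relation_edge _ _⟩
    | of_mul b v ih =>
      obtain ⟨T, hT⟩ := ih
      refine ⟨concat (edge none (some b)) T, ?_⟩
      rw [relation_concat, relation_edge, hT, Set.singleton_mul_singleton]
      rfl
  | of_mul a u ih =>
    obtain ⟨T, hT⟩ := ih
    refine ⟨concat (edge (some a) none) T, ?_⟩
    rw [relation_concat, relation_edge, hT, Set.singleton_mul_singleton]
    rfl

/-- Every rational relation is realized by a rational transducer. -/
theorem exists_relation_eq {R : Set (FreeMonoid A × FreeMonoid B)} (hR : IsRationalSet R) :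
    ∃ T : RationalTransducer A B, T.relation = R := by
  induction hR with
  | @finite S hS =>
    induction S, hS using Set.Finite.induction_on with
    | empty => exact ⟨empty, relation_empty⟩
    | @insert p S _ _ ih =>
      obtain ⟨T, hT⟩ := ih
      obtain ⟨T', hT'⟩ := exists_relation_eq_singleton p.1 p.2
      exact ⟨union T' T, by rw [relation_union, hT, hT', Set.insert_eq]⟩
  | union _ _ ih₁ ih₂ =>
    obtain ⟨T₁, rfl⟩ := ih₁
    obtain ⟨T₂, rfl⟩ := ih₂
    exact ⟨union T₁ T₂, relation_union⟩
  | mul _ _ ih₁ ih₂ =>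
    obtain ⟨T₁, rfl⟩ := ih₁
    obtain ⟨T₂, rfl⟩ := ih₂
    exact ⟨concat T₁ T₂, relation_concat⟩
  | star _ ih =>
    obtain ⟨T, rfl⟩ := ih
    exact ⟨T.star, relation_star⟩

end RationalTransducer

theorem RatDominated.exists_transducer {A B : Type} {L : Language A} {L' : Language B}
    (h : RatDominated L L') : ∃ T : RationalTransducer B A, L = T.image L' := by
  obtain ⟨R, hR, rfl⟩ := h
  obtain ⟨T, rfl⟩ := RationalTransducer.exists_relation_eq hR
  -- `relImage T.relation` and `T.image` agree by definition.
  exact ⟨T, rfl⟩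

/-! ### Paths in described automata -/

namespace NFADescription

variable {A B : Type}

/-- `Path E p u q`: the edges in `E` carry a path from `p` to `q` with label `u`. -/
inductive Path (E : List (List Bool × Option A × List Bool)) :
    List Bool → List A → List Bool → Prop
  | nil (p : List Bool) : Path E p [] p
  | cons {p p' q : List Bool} {a : Option A} {u : List A} :
      (p, a, p') ∈ E → Path E p' u q → Path E p (a.toList ++ u) q

theorem Path.epsilon {E : List (List Bool × Option A × List Bool)} {p p' q : List Bool}
    {u : List A} (h : (p, none, p') ∈ E) (hp : Path E p' u q) : Path E p u q :=
  Path.cons h hp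

theorem init_mem_stateSet (𝒜 : NFADescription A) : 𝒜.init ∈ 𝒜.stateSet := by
  simp [stateSet]

theorem mem_stateSet_of_mem_final {𝒜 : NFADescription A} {p : List Bool} (h : p ∈ 𝒜.final) :
    p ∈ 𝒜.stateSet := by
  simp [stateSet, h]

theorem target_mem_stateSet {𝒜 : NFADescription A} {p q : List Bool} {a : Option A}
    (h : (p, a, q) ∈ 𝒜.trans) : q ∈ 𝒜.stateSet := by
  simp only [stateSet, List.mem_toFinset, List.mem_cons, List.mem_append, List.mem_flatMap]
  exact Or.inr (Or.inr ⟨_, h, by simp⟩)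

theorem Path.of_isPath {𝒜 : NFADescription A} {p q : 𝒜.stateSet} {x : List (Option A)}
    (h : 𝒜.toεNFA.IsPath p q x) : Path 𝒜.trans p x.reduceOption q := by
  induction h with
  | nil => exact Path.nil _
  | cons t s u a x ht _ ih =>
    have := Path.cons (a := a) (show (s.1, a, t.1) ∈ 𝒜.trans from ht) ih
    cases a <;> exact this

theorem Path.exists_isPath {𝒜 : NFADescription A} {p q : List Bool} {u : List A}
    (h : Path 𝒜.trans p u q) (hp : p ∈ 𝒜.stateSet) (hq : q ∈ 𝒜.stateSet) :
    ∃ x : List (Option A), x.reduceOption = u ∧ 𝒜.toεNFA.IsPath ⟨p, hp⟩ ⟨q, hq⟩ x := by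
  induction h with
  | nil => exact ⟨[], rfl, .nil _⟩
  | @cons p p' q a u ht _ ih =>
    obtain ⟨x, rfl, hx⟩ := ih (target_mem_stateSet ht) hq
    refine ⟨a :: x, ?_, .cons ⟨p', target_mem_stateSet ht⟩ _ _ _ _ ht hx⟩
    cases a <;> rfl

/-- Passes from `εNFA` paths, with their subtype of states and `Option`-valued labels, to paths
between plain binary words; only the latter are used for the composition. -/
theorem mem_language_iff {𝒜 : NFADescription A} {u : List A} :
    u ∈ 𝒜.language ↔ ∃ q ∈ 𝒜.final, Path 𝒜.trans 𝒜.init u q := by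
  rw [language, εNFA.mem_accepts_iff_exists_path]
  constructor
  · rintro ⟨s, t, x, hs, ht, rfl, hx⟩
    obtain rfl : s = ⟨𝒜.init, 𝒜.init_mem_stateSet⟩ := Subtype.ext hs
    exact ⟨t, ht, Path.of_isPath hx⟩
  · rintro ⟨q, hq, h⟩
    obtain ⟨x, hx, h⟩ := h.exists_isPath 𝒜.init_mem_stateSet (mem_stateSet_of_mem_final hq)
    exact ⟨_, _, x, rfl, hq, hx, h⟩

end NFADescription

/-! ### Composition of a transducer with a described automaton -/

theorem exists_fixed_length_code (S : Type) [Finite S] :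
    ∃ (n : ℕ) (c : S → List Bool), Function.Injective c ∧ ∀ s, (c s).length = n := by
  obtain ⟨n, ⟨e⟩⟩ := Finite.exists_equiv_fin S
  -- One-hot code: the bit at the index of `s` is the only one that is set.
  refine ⟨n, fun s => List.ofFn fun i => decide (i = e s), fun s t h => ?_, by simp⟩
  have := congrFun (List.ofFn_injective h) (e s)
  simpa using this

namespace RationalTransducer

variable {A B : Type} (T : RationalTransducer B A)

/-- The length of the codes of the states of `T`. -/
noncomputable def codeLength : ℕ :=
  (exists_fixed_length_code (Option T.Q)).choose

/-- Codes of equal length for the states of `T` and a dead state `none`. -/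
noncomputable def code : Option T.Q → List Bool :=
  (exists_fixed_length_code (Option T.Q)).choose_spec.choose

theorem length_code (q : Option T.Q) : (T.code q).length = T.codeLength :=
  (exists_fixed_length_code (Option T.Q)).choose_spec.choose_spec.2 q

theorem code_append_inj {q q' : Option T.Q} {p p' : List Bool} :
    T.code q ++ p = T.code q' ++ p' ↔ q = q' ∧ p = p' := by
  constructor
  · intro h
    obtain ⟨h₁, h₂⟩ := List.append_inj h (by simp only [length_code])
    exact ⟨(exists_fixed_length_code (Option T.Q)).choose_spec.choose_spec.1 h₁, h₂⟩
  · rintro ⟨rfl, rfl⟩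
    rfl

/-- The accepting states as a list. -/
noncomputable def acceptList : List T.Q :=
  (Set.toFinite T.accept).toFinset.toList

theorem mem_acceptList {q : T.Q} : q ∈ T.acceptList ↔ q ∈ T.accept := by
  simp [acceptList]

/-- The moves of `T` relative to an edge of the automaton that runs on the output of `T`: on an
edge with label `l`, a move `(q, b, l, q')` goes from `q` to `q'` and reads `b`. -/
def moveSet : Set (T.Q × Option B × Option A × T.Q) :=
  {t | t ∈ T.trans ∧ t.2.2.1 ≠ none} ∪ {t | t.2.1 = none ∧ t.2.2.1 = none ∧ t.1 = t.2.2.2}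

/-- The transitions of `T` that write nothing. -/
def staySet : Set (T.Q × Option B × T.Q) :=
  {t | (t.1, t.2.1, none, t.2.2) ∈ T.trans}

theorem mem_moveSet {q q' : T.Q} {b : Option B} {l : Option A} : (q, b, l, q') ∈ T.moveSet ↔
    ((q, b, l, q') ∈ T.trans ∧ l ≠ none) ∨ (b = none ∧ l = none ∧ q = q') :=
  Iff.rfl

variable [Finite B]

/-- The list of all transitions that write nothing. -/
noncomputable def stays : List (T.Q × Option B × T.Q) :=
  (Set.toFinite T.staySet).toFinset.toList

theorem mem_stays {q q' : T.Q} {b : Option B} :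
    (q, b, q') ∈ T.stays ↔ (q, b, none, q') ∈ T.trans := by
  simp [stays, staySet]

variable [Finite A]

/-- The list of all moves. -/
noncomputable def moves : List (T.Q × Option B × Option A × T.Q) :=
  (Set.toFinite T.moveSet).toFinset.toList

theorem mem_moves {q q' : T.Q} {b : Option B} {l : Option A} : (q, b, l, q') ∈ T.moves ↔
    ((q, b, l, q') ∈ T.trans ∧ l ≠ none) ∨ (b = none ∧ l = none ∧ q = q') := by
  simp [moves, mem_moveSet]

open scoped Classical in
/-- The state of `T` after the move `t` along an edge with label `l`. -/
noncomputable def moveTarget (t : T.Q × Option B × Option A × T.Q) (l : Option A) :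
    Option T.Q :=
  if l = t.2.2.1 then some t.2.2.2 else none

/-- The edge for the move `t` along the edge `e`. -/
noncomputable def moveEdge (t : T.Q × Option B × Option A × T.Q)
    (e : List Bool × Option A × List Bool) : List Bool × Option B × List Bool :=
  (T.code (some t.1) ++ e.1, t.2.1, T.code (T.moveTarget t e.2.1) ++ e.2.2)

/-- The edge for the transition `t` at the state `p`. -/
noncomputable def stayEdge (t : T.Q × Option B × T.Q) (p : List Bool) :
    List Bool × Option B × List Bool :=
  (T.code (some t.1) ++ p, t.2.1, T.code (some t.2.2) ++ p)

/-- The automaton `T ∘ 𝒜` over the input alphabet of `T`. -/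
noncomputable def compose (𝒜 : NFADescription A) : NFADescription B where
  init := T.code (some T.start) ++ 𝒜.init
  states := []
  final := T.acceptList.flatMap fun q => 𝒜.final.map fun p => T.code (some q) ++ p
  trans :=
    (T.moves.flatMap fun t => 𝒜.trans.map (T.moveEdge t)) ++
    T.stays.flatMap fun t => (𝒜.init :: 𝒜.trans.map fun e => e.2.2).map (T.stayEdge t)

/-! ### The language of the composed automaton. -/

open NFADescription

variable {T} {𝒜 : NFADescription A}

theorem move_mem_compose {q q' : T.Q} {b : Option B} {l : Option A} {p p' : List Bool}
    (ht : (q, b, l, q') ∈ T.moves) (he : (p, l, p') ∈ 𝒜.trans) :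
    (T.code (some q) ++ p, b, T.code (some q') ++ p') ∈ (T.compose 𝒜).trans := by
  refine List.mem_append_left _ (List.mem_flatMap.2 ⟨_, ht, List.mem_map.2 ⟨_, he, ?_⟩⟩)
  simp [moveEdge, moveTarget]

theorem stay_mem_compose {q q' : T.Q} {b : Option B} {p : List Bool}
    (ht : (q, b, none, q') ∈ T.trans) (hp : p ∈ 𝒜.init :: 𝒜.trans.map fun e => e.2.2) :
    (T.code (some q) ++ p, b, T.code (some q') ++ p) ∈ (T.compose 𝒜).trans :=
  List.mem_append_right _
    (List.mem_flatMap.2 ⟨_, T.mem_stays.2 ht, List.mem_map.2 ⟨_, hp, rfl⟩⟩)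

/-- The three cases are a matching move, a waiting step of `𝒜`, and a mismatched edge into the dead
state. Every source carries a code `some q`, hence nothing leaves the dead state. -/
theorem mem_compose_trans {s s' : List Bool} {b : Option B}
    (h : (s, b, s') ∈ (T.compose 𝒜).trans) :
    (∃ q q' l p p', (q, b, l, q') ∈ T.moves ∧ (p, l, p') ∈ 𝒜.trans ∧
      s = T.code (some q) ++ p ∧ s' = T.code (some q') ++ p') ∨
    (∃ q q' p, (q, b, none, q') ∈ T.trans ∧ s = T.code (some q) ++ p ∧
      s' = T.code (some q') ++ p) ∨
    ∃ q p p', s = T.code (some q) ++ p ∧ s' = T.code none ++ p' := by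
  rcases List.mem_append.1 h with h | h
  · obtain ⟨⟨q, b, l, q'⟩, ht, h⟩ := List.mem_flatMap.1 h
    obtain ⟨⟨p, l', p'⟩, he, h⟩ := List.mem_map.1 h
    obtain ⟨rfl, rfl, rfl⟩ : _ ∧ _ ∧ _ := by simpa only [moveEdge, Prod.mk.injEq] using h
    by_cases hl : l' = l
    · subst hl
      exact Or.inl ⟨q, q', l', p, p', ht, he, rfl, by simp [moveTarget]⟩
    · exact Or.inr (Or.inr ⟨q, p, p', rfl, by simp [moveTarget, hl]⟩)
  · obtain ⟨⟨q, b, q'⟩, ht, h⟩ := List.mem_flatMap.1 h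
    obtain ⟨p, _, h⟩ := List.mem_map.1 h
    obtain ⟨rfl, rfl, rfl⟩ : _ ∧ _ ∧ _ := by simpa only [stayEdge, Prod.mk.injEq] using h
    exact Or.inr (Or.inl ⟨q, q', p, T.mem_stays.1 ht, rfl, rfl⟩)

theorem mem_compose_final {s : List Bool} : s ∈ (T.compose 𝒜).final ↔
    ∃ q ∈ T.accept, ∃ p ∈ 𝒜.final, s = T.code (some q) ++ p := by
  simp [compose, mem_acceptList, eq_comm]

/-- Consumes the leading `ε`-edges of a path of `𝒜` while `T` waits in `q`. The hypotheses `hy` and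
`hy'` are the continuations once these edges are used up: either the path is over, or an edge with a
letter comes next. -/
theorem path_compose_of_path (q : T.Q) {p p' s : List Bool} {y : List A} {w : List B}
    (h : Path 𝒜.trans p y p') (hp : p ∈ 𝒜.init :: 𝒜.trans.map fun e => e.2.2)
    (hy : y = [] → Path (T.compose 𝒜).trans (T.code (some q) ++ p') w s)
    (hy' : ∀ a y' p₁, y = a :: y' → p₁ ∈ 𝒜.init :: 𝒜.trans.map (fun e => e.2.2) →
      ∀ p₂, (p₁, some a, p₂) ∈ 𝒜.trans → Path 𝒜.trans p₂ y' p' →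
      Path (T.compose 𝒜).trans (T.code (some q) ++ p₁) w s) :
    Path (T.compose 𝒜).trans (T.code (some q) ++ p) w s := by
  induction h with
  | nil => exact hy rfl
  | @cons p p₁ p' a y he hpath ih =>
    cases a with
    | some a => exact hy' a y p rfl hp _ he hpath
    | none =>
      exact Path.epsilon (move_mem_compose (T.mem_moves.2 (Or.inr ⟨rfl, rfl, rfl⟩)) he)
        (ih (List.mem_cons_of_mem _ (List.mem_map_of_mem he)) hy hy')

/-- Induction on the run of `T`, with `𝒜` catching up whenever a letter is written. The invariant
`hp` holds because a path from the initial state only meets that state and targets of edges; waiting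
steps are provided at exactly these states. -/
theorem path_compose_of_run {q q' : T.Q} {w : List B} {y : List A} (h : T.Run q w y q')
    {p p' : List Bool} (hp : p ∈ 𝒜.init :: 𝒜.trans.map fun e => e.2.2)
    (hpath : Path 𝒜.trans p y p') :
    Path (T.compose 𝒜).trans (T.code (some q) ++ p) w (T.code (some q') ++ p') := by
  induction h generalizing p with
  | nil q =>
    exact path_compose_of_path q hpath hp (fun _ => Path.nil _) nofun
  | @cons q q₁ q' b a w y ht _ ih =>
    cases a with
    | none => exact Path.cons (stay_mem_compose ht hp) (ih hp hpath)
    | some a =>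
      refine path_compose_of_path q hpath hp nofun fun a' y' p₁ h hp₁ p₂ he h₂ => ?_
      obtain ⟨rfl, rfl⟩ : a = a' ∧ y = y' := by simpa using h
      exact Path.cons (move_mem_compose (T.mem_moves.2 (Or.inl ⟨ht, by simp⟩)) he)
        (ih (List.mem_cons_of_mem _ (List.mem_map_of_mem he)) h₂)

/-- Induction from the end of the path. As the last state has a live code and the dead state has no
way out, mismatched edges cannot occur on such a path; each remaining edge projects to a step of
`T`, of `𝒜`, or of both. -/
theorem exists_run_of_path_compose {s s' : List Bool} {w : List B}
    (h : Path (T.compose 𝒜).trans s w s') {q' : T.Q} {p' : List Bool}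
    (hs' : s' = T.code (some q') ++ p') {x : Option T.Q} {p : List Bool}
    (hs : s = T.code x ++ p) :
    ∃ q, x = some q ∧ ∃ y, T.Run q w y q' ∧ Path 𝒜.trans p y p' := by
  induction h generalizing x p with
  | nil s =>
    subst hs'
    obtain ⟨rfl, rfl⟩ := T.code_append_inj.1 hs
    exact ⟨q', rfl, [], Run.nil _, Path.nil _⟩
  | cons he _ ih =>
    rcases mem_compose_trans he with ⟨q, q₁, l, p₁, p₂, ht, he', rfl, rfl⟩ |
      ⟨q, q₁, p₁, ht, rfl, rfl⟩ | ⟨q, p₁, p₂, rfl, rfl⟩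
    · obtain ⟨rfl, rfl⟩ := T.code_append_inj.1 hs
      obtain ⟨q₂, hq, y, hrun, hpath⟩ := ih hs' rfl
      cases hq
      rcases T.mem_moves.1 ht with ⟨ht, -⟩ | ⟨rfl, rfl, rfl⟩
      · exact ⟨q, rfl, _, Run.cons ht hrun, Path.cons he' hpath⟩
      · exact ⟨q, rfl, y, hrun, Path.epsilon he' hpath⟩
    · obtain ⟨rfl, rfl⟩ := T.code_append_inj.1 hs
      obtain ⟨q₂, hq, y, hrun, hpath⟩ := ih hs' rfl
      cases hq
      exact ⟨q, rfl, y, Run.cons ht hrun, hpath⟩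
    · obtain ⟨q₂, hq, -⟩ := ih hs' rfl
      cases hq

theorem mem_language_compose {w : List B} :
    w ∈ (T.compose 𝒜).language ↔ ∃ y ∈ 𝒜.language, T.Realizes w y := by
  simp only [mem_language_iff]
  constructor
  · rintro ⟨s, hs, h⟩
    obtain ⟨q', hq', p', hp', rfl⟩ := mem_compose_final.1 hs
    obtain ⟨q, hq, y, hrun, hpath⟩ := exists_run_of_path_compose h rfl rfl
    cases hq
    exact ⟨y, ⟨p', hp', hpath⟩, q', hq', hrun⟩
  · rintro ⟨y, ⟨p', hp', hpath⟩, q', hq', hrun⟩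
    exact ⟨_, mem_compose_final.2 ⟨q', hq', p', hp', rfl⟩,
      path_compose_of_run hrun List.mem_cons_self hpath⟩

end RationalTransducer

/-! ### Two-way machines that sweep repeatedly over the input -/

/-- A sweep program. Some input letters are copyable: `copy i = some o` means that `o` is the copy
of `i`. The program treats every other cell as the head of a block, which consists of this cell
and the copyable letters that follow it. A sweep visits the blocks from left to right; at the
block with head `c` it writes `act s c`, where `none` stands for a copy of the letters of the
block, and changes its state to `next s c`. After a sweep that ends in the state `s`, a new one
starts in the state `again s`, if there is any. -/
structure SweepProgram (I O : Type) where
  copy : I → Option O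
  S : Type
  [finiteS : Finite S]
  start : S
  act : S → InputCell I → List (Option O)
  next : S → InputCell I → S
  again : S → Option S

namespace SweepProgram

attribute [instance] SweepProgram.finiteS

variable {I O : Type}

/-- The phases of the machine that executes a sweep program. -/
inductive Phase
  | load
  | write
  | copy
  | back
  | skip
  | rewind

instance : Finite Phase :=
  Finite.of_surjective (fun i : Fin 6 => match i with
    | 0 => .load
    | 1 => .write
    | 2 => .copy
    | 3 => .back
    | 4 => .skip
    | 5 => .rewind) fun p => by
      cases p
      exacts [⟨0, rfl⟩, ⟨1, rfl⟩, ⟨2, rfl⟩, ⟨3, rfl⟩, ⟨4, rfl⟩, ⟨5, rfl⟩]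

theorem finite_inputCell [Finite I] : Finite (InputCell I) :=
  Finite.of_surjective (fun i : Option (Option I) => match i with
    | none => .leftEnd
    | some none => .rightEnd
    | some (some i) => .letter i) fun c => by
      cases c with
      | leftEnd => exact ⟨none, rfl⟩
      | letter i => exact ⟨some (some i), rfl⟩
      | rightEnd => exact ⟨some none, rfl⟩

variable (P : SweepProgram I O)

/-- What can remain to be written at a block. -/
abbrev Pending : Type :=
  {l : List (Option O) // ∃ s c, l <:+ P.act s c}

instance [Finite I] : Finite P.Pending := by
  -- There are finitely many right-hand sides `P.act s c`, each with finitely many suffixes.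
  have : Finite (InputCell I) := finite_inputCell
  have h := Set.finite_iUnion fun s => Set.finite_iUnion fun c => (P.act s c).tails.finite_toSet
  refine (h.subset (t := {l | ∃ s c, l <:+ P.act s c}) ?_).to_subtype
  rintro l ⟨s, c, h⟩
  exact Set.mem_iUnion.2 ⟨s, Set.mem_iUnion.2 ⟨c, (List.mem_tails _ _).2 h⟩⟩

/-- Nothing remains to be written. -/
def Pending.nil : P.Pending :=
  ⟨[], P.start, .leftEnd, List.nil_suffix⟩

/-- The copy of an input cell. -/
def copyCell : InputCell I → Option O
  | .letter i => P.copy i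
  | _ => none

/-- The states of the machine that executes the program. -/
abbrev State : Type := Phase × P.S × P.Pending

/-- The transition function of the machine that executes the program. -/
def transition : P.State → InputCell I → Option (P.State × HeadMove × Option O)
  | (.load, s, _), .rightEnd => (P.again s).map fun s' => ((.rewind, s', .nil P), .left, none)
  | (.load, s, _), c => some ((.write, s, ⟨P.act s c, s, c, List.suffix_rfl⟩), .stay, none)
  | (.write, s, ⟨[], _⟩), c => some ((.skip, P.next s c, .nil P), .right, none)
  | (.write, s, ⟨some o :: l, h⟩), _ =>
    some ((.write, s, ⟨l, h.imp fun _ h => h.imp fun _ h => (List.suffix_cons _ _).trans h⟩),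
      .stay, some o)
  | (.write, s, ⟨none :: l, h⟩), _ =>
    some ((.copy, s, ⟨l, h.imp fun _ h => h.imp fun _ h => (List.suffix_cons _ _).trans h⟩),
      .right, none)
  | (.copy, s, l), c => match P.copyCell c with
    | some o => some ((.copy, s, l), .right, some o)
    | none => some ((.back, s, l), .left, none)
  | (.back, s, l), c => match P.copyCell c with
    | some _ => some ((.back, s, l), .left, none)
    | none => some ((.write, s, l), .stay, none)
  | (.skip, s, l), c => match P.copyCell c with
    | some _ => some ((.skip, s, l), .right, none)
    | none => some ((.load, s, l), .stay, none)
  | (.rewind, s, l), .leftEnd => some ((.load, s, l), .stay, none)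
  | (.rewind, s, l), _ => some ((.rewind, s, l), .left, none)

/-- The machine that executes the program. It needs no work tape. -/
def toTM [Finite I] : SpaceTM I O where
  Q := P.State
  Γ := Unit
  blank := ()
  tapes := 0
  start := (.load, P.start, .nil P)
  δ q c _ := (P.transition q c).map fun t =>
    { state := t.1
      inputMove := t.2.1
      write := fun _ => ()
      workMove := fun _ => .stay
      emit := t.2.2 }

/-- The configuration with a given state, head position and output. -/
def cfg [Finite I] (q : P.State) (p : ℕ) (o : List O) : P.toTM.Cfg where
  state := q
  inputHead := p
  work := fun _ _ => ()
  workHead := fun _ => 0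
  output := o

/-- The input word between its endmarkers, without the right one. -/
def tape (x : List I) : List (InputCell I) :=
  .leftEnd :: x.map .letter

theorem inputCell_eq {x : List I} {u v : List (InputCell I)} {c : InputCell I}
    (h : tape x = u ++ c :: v) : SpaceTM.inputCell x u.length = c := by
  have hc : (tape x)[u.length]? = some c := by simp [h]
  rcases u with _ | ⟨d, u⟩
  · simpa [tape, SpaceTM.inputCell] using hc
  · simp only [tape, List.length_cons, List.getElem?_cons_succ, List.getElem?_map,
      Option.map_eq_some_iff] at hc
    obtain ⟨i, hi, rfl⟩ := hc
    simp [SpaceTM.inputCell, hi]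

theorem inputCell_length (x : List I) : SpaceTM.inputCell x (x.length + 1) = .rightEnd := by
  simp [SpaceTM.inputCell]

theorem length_tape (x : List I) : (tape x).length = x.length + 1 := by
  simp [tape]

/-! ### Execution of a sweep program by its machine. -/

section Execution

variable [Finite I] {P} {x : List I}

/-- The machine gets from one configuration to another. -/
def Reaches (x : List I) : P.toTM.Cfg → P.toTM.Cfg → Prop :=
  StateTransition.Reaches (P.toTM.step x)

theorem Reaches.refl (c : P.toTM.Cfg) : Reaches x c c :=
  Relation.ReflTransGen.refl

theorem Reaches.trans {c d e : P.toTM.Cfg} (h : Reaches x c d) (h' : Reaches x d e) :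
    Reaches x c e :=
  Relation.ReflTransGen.trans h h'

/-- Work data never change, so a step is determined by the control state, the input head and the
output. -/
theorem step_cfg (q : P.State) (p : ℕ) (o : List O) : P.toTM.step x (P.cfg q p o) =
    (P.transition q (SpaceTM.inputCell x p)).map fun t =>
      P.cfg t.1 (min (SpaceTM.moveHead t.2.1 p) (x.length + 1)) (o ++ t.2.2.toList) := by
  simp only [SpaceTM.step, toTM, cfg, Option.map_map]
  rfl

theorem reaches_of_transition {q q' : P.State} {p p' : ℕ} {o : List O} {m : HeadMove}
    {e : Option O} (h : P.transition q (SpaceTM.inputCell x p) = some (q', m, e))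
    (hp : SpaceTM.moveHead m p = p') (hp' : p' ≤ x.length + 1) :
    Reaches x (P.cfg q p o) (P.cfg q' p' (o ++ e.toList)) := by
  refine Relation.ReflTransGen.single ?_
  rw [step_cfg, h]
  subst hp
  simp [hp']

theorem reaches_copy {s : P.S} {l : P.Pending} {w : List I} {u v : List (InputCell I)}
    {o : List O} (hx : tape x = u ++ w.map .letter ++ v) (hw : ∀ i ∈ w, (P.copy i).isSome) :
    Reaches x (P.cfg (.copy, s, l) u.length o)
      (P.cfg (.copy, s, l) (u.length + w.length) (o ++ w.filterMap P.copy)) := by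
  induction w generalizing u o with
  | nil => simpa using Reaches.refl _
  | cons i w ih =>
    obtain ⟨a, ha⟩ := Option.isSome_iff_exists.1 (hw i List.mem_cons_self)
    have hcell : SpaceTM.inputCell x u.length = .letter i :=
      inputCell_eq (v := w.map .letter ++ v) (by simpa using hx)
    have hlen := congrArg List.length hx
    simp only [length_tape, List.length_append, List.length_map, List.length_cons] at hlen
    have h₁ : Reaches x (P.cfg (.copy, s, l) u.length o)
        (P.cfg (.copy, s, l) (u.length + 1) (o ++ [a])) :=
      reaches_of_transition (m := .right) (e := some a)
        (by simp [transition, hcell, copyCell, ha]) rfl (by omega)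
    have h₂ := ih (u := u ++ [.letter i]) (o := o ++ [a]) (by simpa using hx)
      fun j hj => hw j (List.mem_cons_of_mem _ hj)
    refine h₁.trans ?_
    simpa [ha, Nat.add_assoc, Nat.add_comm 1] using h₂

theorem reaches_skip {s : P.S} {l : P.Pending} {w : List I} {u v : List (InputCell I)}
    {o : List O} (hx : tape x = u ++ w.map .letter ++ v) (hw : ∀ i ∈ w, (P.copy i).isSome) :
    Reaches x (P.cfg (.skip, s, l) u.length o)
      (P.cfg (.skip, s, l) (u.length + w.length) o) := by
  induction w generalizing u with
  | nil => simpa using Reaches.refl _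
  | cons i w ih =>
    obtain ⟨a, ha⟩ := Option.isSome_iff_exists.1 (hw i List.mem_cons_self)
    have hcell : SpaceTM.inputCell x u.length = .letter i :=
      inputCell_eq (v := w.map .letter ++ v) (by simpa using hx)
    have hlen := congrArg List.length hx
    simp only [length_tape, List.length_append, List.length_map, List.length_cons] at hlen
    have h₁ : Reaches x (P.cfg (.skip, s, l) u.length o)
        (P.cfg (.skip, s, l) (u.length + 1) (o ++ (none : Option O).toList)) :=
      reaches_of_transition (m := .right) (e := none)
        (by simp [transition, hcell, copyCell, ha]) rfl (by omega)
    have h₂ := ih (u := u ++ [.letter i]) (by simpa using hx)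
      fun j hj => hw j (List.mem_cons_of_mem _ hj)
    rw [Option.toList_none, List.append_nil] at h₁
    refine h₁.trans ?_
    simpa [Nat.add_assoc, Nat.add_comm 1] using h₂

theorem reaches_back {s : P.S} {l : P.Pending} {w : List I} {u v : List (InputCell I)}
    {c : InputCell I} {o : List O} (hx : tape x = u ++ c :: w.map .letter ++ v)
    (hw : ∀ i ∈ w, (P.copy i).isSome) :
    Reaches x (P.cfg (.back, s, l) (u.length + w.length) o) (P.cfg (.back, s, l) u.length o) := by
  -- The head moves leftwards, so the last letter of the block is treated first.
  induction w using List.reverseRecOn generalizing v with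
  | nil => simpa using Reaches.refl _
  | append_singleton w i ih =>
    obtain ⟨a, ha⟩ := Option.isSome_iff_exists.1 (hw i (by simp))
    have hcell : SpaceTM.inputCell x (u ++ c :: w.map .letter).length = .letter i :=
      inputCell_eq (v := v) (by simpa using hx)
    have hlen := congrArg List.length hx
    simp only [length_tape, List.length_append, List.length_map, List.length_cons,
      List.length_nil] at hlen hcell ⊢
    have h₁ : Reaches x (P.cfg (.back, s, l) (u.length + (w.length + 1)) o)
        (P.cfg (.back, s, l) (u.length + w.length) (o ++ (none : Option O).toList)) :=
      reaches_of_transition (m := .left) (e := none)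
        (by simp [transition, hcell, copyCell, ha]) rfl (by omega)
    rw [Option.toList_none, List.append_nil] at h₁
    exact h₁.trans (ih (v := .letter i :: v) (by simpa using hx) fun j hj => hw j (by simp [hj]))

theorem reaches_rewind {s : P.S} {l : P.Pending} {p : ℕ} {o : List O} (hp : p ≤ x.length + 1) :
    Reaches x (P.cfg (.rewind, s, l) p o) (P.cfg (.load, s, l) 0 o) := by
  induction p with
  | zero =>
    simpa using reaches_of_transition (P := P) (x := x) (p := 0) (p' := 0) (o := o) (m := .stay)
      (e := none) (q := (.rewind, s, l)) (q' := (.load, s, l)) rfl rfl (Nat.zero_le _)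
  | succ p ih =>
    have h₁ : Reaches x (P.cfg (.rewind, s, l) (p + 1) o)
        (P.cfg (.rewind, s, l) p (o ++ (none : Option O).toList)) := by
      refine reaches_of_transition (m := .left) (e := none) ?_ rfl (by omega)
      simp only [SpaceTM.inputCell]
      cases x[p]? <;> rfl
    rw [Option.toList_none, List.append_nil] at h₁
    exact h₁.trans (ih (by omega))

/-- A block of the input: a cell and the letters that follow it. -/
abbrev Block (I : Type) : Type := InputCell I × List I

/-- The cells of a block. -/
def Block.cells (b : Block I) : List (InputCell I) :=
  b.1 :: b.2.map .letter

variable (P) in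
/-- The first cell of the block is not copyable, but the other ones are. -/
def IsBlock (b : Block I) : Prop :=
  P.copyCell b.1 = none ∧ b.1 ≠ .rightEnd ∧ ∀ i ∈ b.2, (P.copy i).isSome

/-- The word that is written at a block, `w` being the copy of the block. -/
def expand (l : List (Option O)) (w : List O) : List O :=
  l.flatMap fun i => match i with
    | some o => [o]
    | none => w

/-- For each `none` the machine runs over the letters of the block while copying them, stops at the
first cell that is not copyable, and walks back to the head of the block. That the cell after the
block stops it is ensured by `hv`, or by the right endmarker if nothing follows. -/
theorem reaches_write {s : P.S} {b : Block I} {l : P.Pending} {u v : List (InputCell I)}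
    {o : List O} (hx : tape x = u ++ b.cells ++ v) (hb : P.IsBlock b)
    (hv : ∀ c ∈ v.head?, P.copyCell c = none) :
    Reaches x (P.cfg (.write, s, l) u.length o)
      (P.cfg (.write, s, .nil P) u.length (o ++ expand l.1 (b.2.filterMap P.copy))) := by
  obtain ⟨hb₁, -, hb₂⟩ := hb
  have hlen := congrArg List.length hx
  simp only [length_tape, List.length_append, Block.cells, List.length_map,
    List.length_cons] at hlen
  obtain ⟨l, hl⟩ := l
  induction l generalizing o with
  | nil => simpa [expand, Pending.nil] using Reaches.refl _
  | cons a l ih =>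
    have hl' : ∃ s c, l <:+ P.act s c :=
      hl.imp fun _ h => h.imp fun _ h => (List.suffix_cons _ _).trans h
    cases a with
    | some a =>
      have h₁ : Reaches x (P.cfg (.write, s, ⟨some a :: l, hl⟩) u.length o)
          (P.cfg (.write, s, ⟨l, hl'⟩) u.length (o ++ [a])) :=
        reaches_of_transition (m := .stay) (e := some a) rfl rfl (by omega)
      simpa [expand] using h₁.trans (ih hl')
    | none =>
      have h₁ : Reaches x (P.cfg (.write, s, ⟨none :: l, hl⟩) u.length o)
          (P.cfg (.copy, s, ⟨l, hl'⟩) (u.length + 1) (o ++ (none : Option O).toList)) :=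
        reaches_of_transition (m := .right) (e := none) rfl rfl (by omega)
      have h₂ := reaches_copy (P := P) (s := s) (l := ⟨l, hl'⟩) (o := o) (u := u ++ [b.1])
        (w := b.2) (v := v) (by simpa [Block.cells] using hx) hb₂
      -- The copying phase ends here: this cell is the right endmarker or the first cell of `v`.
      have hcell : P.copyCell (SpaceTM.inputCell x (u.length + 1 + b.2.length)) = none := by
        rcases v with _ | ⟨c, v⟩
        · have : u.length + 1 + b.2.length = x.length + 1 := by
            simp only [List.length_nil] at hlen
            omega
          rw [this, inputCell_length]
          rfl
        · have := inputCell_eq (x := x) (u := u ++ b.cells) (c := c) (v := v) hx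
          simp only [List.length_append, Block.cells, List.length_cons, List.length_map] at this
          rw [show u.length + 1 + b.2.length = u.length + (b.2.length + 1) by omega, this]
          exact hv c rfl
      have h₃ : Reaches x
          (P.cfg (.copy, s, ⟨l, hl'⟩) (u.length + 1 + b.2.length) (o ++ b.2.filterMap P.copy))
          (P.cfg (.back, s, ⟨l, hl'⟩) (u.length + b.2.length)
            (o ++ b.2.filterMap P.copy ++ (none : Option O).toList)) :=
        reaches_of_transition (m := .left) (e := none) (by simp [transition, hcell])
          (by simp only [SpaceTM.moveHead]; omega) (by omega)
      have h₄ := reaches_back (P := P) (s := s) (l := ⟨l, hl'⟩) (o := o ++ b.2.filterMap P.copy)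
        (u := u) (c := b.1) (w := b.2) (v := v) (by simpa [Block.cells] using hx) hb₂
      have hhead : SpaceTM.inputCell x u.length = b.1 :=
        inputCell_eq (v := b.2.map .letter ++ v) (by simpa [Block.cells] using hx)
      have h₅ : Reaches x (P.cfg (.back, s, ⟨l, hl'⟩) u.length (o ++ b.2.filterMap P.copy))
          (P.cfg (.write, s, ⟨l, hl'⟩) u.length
            (o ++ b.2.filterMap P.copy ++ (none : Option O).toList)) :=
        reaches_of_transition (m := .stay) (e := none)
          (by simp [transition, hhead, hb₁]) rfl (by omega)
      simp only [Option.toList_none, List.append_nil, List.length_append, List.length_cons,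
        List.length_nil, Nat.zero_add] at h₁ h₂ h₃ h₅
      have h₆ := ih (o := o ++ b.2.filterMap P.copy) hl'
      simpa [expand] using h₁.trans (h₂.trans (h₃.trans (h₄.trans (h₅.trans h₆))))

theorem reaches_block {s : P.S} {b : Block I} {u v : List (InputCell I)}
    {o : List O} (hx : tape x = u ++ b.cells ++ v) (hb : P.IsBlock b)
    (hv : ∀ c ∈ v.head?, P.copyCell c = none) :
    Reaches x (P.cfg (.load, s, .nil P) u.length o)
      (P.cfg (.load, P.next s b.1, .nil P) (u ++ b.cells).length
        (o ++ expand (P.act s b.1) (b.2.filterMap P.copy))) := by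
  have hlen := congrArg List.length hx
  simp only [length_tape, List.length_append, Block.cells, List.length_map,
    List.length_cons] at hlen
  have hhead : SpaceTM.inputCell x u.length = b.1 :=
    inputCell_eq (v := b.2.map .letter ++ v) (by simpa [Block.cells] using hx)
  have h₁ : Reaches x (P.cfg (.load, s, .nil P) u.length o)
      (P.cfg (.write, s, ⟨P.act s b.1, s, b.1, List.suffix_rfl⟩) u.length
        (o ++ (none : Option O).toList)) := by
    refine reaches_of_transition (m := .stay) (e := none) ?_ rfl (by omega)
    rw [hhead]
    obtain ⟨c, w⟩ := b
    cases c with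
    | rightEnd => exact absurd rfl hb.2.1
    | _ => rfl
  have h₂ := reaches_write (P := P) (s := s) (o := o)
    (l := ⟨P.act s b.1, s, b.1, List.suffix_rfl⟩) hx hb hv
  have h₃ : ∀ o, Reaches x (P.cfg (.write, s, .nil P) u.length o)
      (P.cfg (.skip, P.next s b.1, .nil P) (u.length + 1) (o ++ (none : Option O).toList)) :=
    fun o => reaches_of_transition (m := .right) (e := none)
      (by rw [hhead]; rfl) rfl (by omega)
  have h₄ := fun o => reaches_skip (P := P) (s := P.next s b.1) (l := .nil P) (o := o)
    (u := u ++ [b.1]) (w := b.2) (v := v) (by simpa [Block.cells] using hx) hb.2.2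
  have hcell : P.copyCell (SpaceTM.inputCell x (u ++ b.cells).length) = none := by
    rcases v with _ | ⟨c, v⟩
    · have : (u ++ b.cells).length = x.length + 1 := by
        rw [← length_tape, hx, List.append_nil]
      rw [this, inputCell_length]
      rfl
    · rw [inputCell_eq (x := x) (u := u ++ b.cells) (c := c) (v := v) hx]
      exact hv c rfl
  have h₅ : ∀ o, Reaches x (P.cfg (.skip, P.next s b.1, .nil P) (u ++ b.cells).length o)
      (P.cfg (.load, P.next s b.1, .nil P) (u ++ b.cells).length
        (o ++ (none : Option O).toList)) :=
    fun o => reaches_of_transition (m := .stay) (e := none)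
      (by simp only [transition, hcell]) rfl
      (by simp only [List.length_append, Block.cells, List.length_map, List.length_cons]; omega)
  have hpos : (u ++ [b.1]).length + b.2.length = (u ++ b.cells).length := by
    simp only [List.length_append, Block.cells, List.length_map, List.length_cons,
      List.length_nil]
    omega
  rw [hpos] at h₄
  simp only [Option.toList_none, List.append_nil] at h₁ h₃ h₅
  rw [show u.length + 1 = (u ++ [b.1]).length by simp] at h₃
  exact h₁.trans (h₂.trans ((h₃ _).trans ((h₄ _).trans (h₅ _))))

variable (P) in
/-- The output of a sweep over the blocks `bs` that starts in the state `s`. -/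
def sweepOutput (s : P.S) : List (Block I) → List O
  | [] => []
  | b :: bs => expand (P.act s b.1) (b.2.filterMap P.copy) ++ sweepOutput (P.next s b.1) bs

variable (P) in
/-- The state after a sweep over the blocks `bs` that starts in the state `s`. -/
def sweepState (s : P.S) (bs : List (Block I)) : P.S :=
  bs.foldl (fun s b => P.next s b.1) s

theorem reaches_sweep {s : P.S} {bs : List (Block I)} {u : List (InputCell I)} {o : List O}
    (hx : tape x = u ++ bs.flatMap Block.cells) (hbs : ∀ b ∈ bs, P.IsBlock b) :
    Reaches x (P.cfg (.load, s, .nil P) u.length o)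
      (P.cfg (.load, P.sweepState s bs, .nil P) (x.length + 1) (o ++ P.sweepOutput s bs)) := by
  induction bs generalizing s u o with
  | nil =>
    have : u.length = x.length + 1 := by simp [← length_tape, hx]
    rw [this]
    simpa [sweepOutput, sweepState] using Reaches.refl _
  | cons b bs ih =>
    have h₁ := reaches_block (P := P) (s := s) (o := o) (b := b) (u := u)
      (v := bs.flatMap Block.cells) (by simpa using hx) (hbs b List.mem_cons_self) (by
        rcases bs with _ | ⟨b', bs⟩
        · simp
        · rintro c hc
          obtain rfl : b'.1 = c := by simpa [Block.cells] using hc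
          exact (hbs b' (by simp)).1)
    have h₂ := ih (s := P.next s b.1) (u := u ++ b.cells)
      (o := o ++ expand (P.act s b.1) (b.2.filterMap P.copy)) (by simpa using hx)
      fun b' hb' => hbs b' (List.mem_cons_of_mem _ hb')
    simpa [sweepOutput, sweepState] using h₁.trans h₂

variable (P) in
/-- `P.Run bs s o`: on the input with the blocks `bs`, the program started in the state `s` writes
`o` and stops. -/
inductive Run (bs : List (Block I)) : P.S → List O → Prop
  | halt {s : P.S} : P.again (P.sweepState s bs) = none → Run bs s (P.sweepOutput s bs)
  | again {s s' : P.S} {o : List O} : P.again (P.sweepState s bs) = some s' → Run bs s' o →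
      Run bs s (P.sweepOutput s bs ++ o)

theorem Run.halts {s : P.S} {bs : List (Block I)} {o' : List O} (h : P.Run bs s o')
    (hx : tape x = bs.flatMap Block.cells) (hbs : ∀ b ∈ bs, P.IsBlock b) (o : List O) :
    ∃ c, Reaches x (P.cfg (.load, s, .nil P) 0 o) c ∧ P.toTM.step x c = none ∧
      c.output = o ++ o' := by
  induction h generalizing o with
  | @halt s h =>
    refine ⟨_, reaches_sweep (u := []) hx hbs, ?_, rfl⟩
    simp [step_cfg, inputCell_length, transition, h]
  | @again s s' o' h _ ih =>
    obtain ⟨c, hc, hstep, hout⟩ := ih (o ++ P.sweepOutput s bs)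
    have h₁ := reaches_sweep (P := P) (s := s) (o := o) (u := []) hx hbs
    have h₂ : Reaches x
        (P.cfg (.load, P.sweepState s bs, .nil P) (x.length + 1) (o ++ P.sweepOutput s bs))
        (P.cfg (.rewind, s', .nil P) x.length
          (o ++ P.sweepOutput s bs ++ (none : Option O).toList)) :=
      reaches_of_transition (m := .left) (e := none)
        (by simp [inputCell_length, transition, h]) rfl (by omega)
    rw [Option.toList_none, List.append_nil] at h₂
    exact ⟨c, h₁.trans (h₂.trans ((reaches_rewind (by omega)).trans hc)), hstep,
      by rw [hout, List.append_assoc]⟩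

theorem Run.outputs {bs : List (Block I)} {o : List O} (h : P.Run bs P.start o)
    (hx : tape x = bs.flatMap Block.cells) (hbs : ∀ b ∈ bs, P.IsBlock b) :
    P.toTM.Outputs x o :=
  h.halts hx hbs []

end Execution

/-- Without work tapes the space bound is vacuous, so the constant `0` serves. -/
theorem logSpaceComputable [Finite I] {f : List I → List O} (h : ∀ x, P.toTM.Outputs x (f x)) :
    LogSpaceComputable f :=
  ⟨P.toTM, 0, fun x => ⟨h x, fun _ _ i => i.elim0⟩⟩

end SweepProgram

/-! ### Encodings as sequences of blocks -/

/-- The symbols that start a part of an encoding. -/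
inductive Marker (A : Type)
  | init
  | state
  | final
  | edge
  | label (a : Option A)

namespace Marker

variable {A : Type}

/-- The symbol for a marker. -/
def symbol : Marker A → NFASymbol A
  | init => .init
  | state => .state
  | final => .final
  | edge => .edge
  | label a => .label a

/-- A marker followed by a binary word. -/
def blockWord (b : Marker A × List Bool) : List (NFASymbol A) :=
  b.1.symbol :: b.2.map .bit

/-- The leading bits of a word, and the blocks that follow them. -/
def parse : List (NFASymbol A) → List Bool × List (Marker A × List Bool)
  | [] => ([], [])
  | .bit b :: x => (b :: (parse x).1, (parse x).2)
  | .init :: x => ([], (init, (parse x).1) :: (parse x).2)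
  | .state :: x => ([], (state, (parse x).1) :: (parse x).2)
  | .final :: x => ([], (final, (parse x).1) :: (parse x).2)
  | .edge :: x => ([], (edge, (parse x).1) :: (parse x).2)
  | .label a :: x => ([], (label a, (parse x).1) :: (parse x).2)

theorem parse_symbol (m : Marker A) (x : List (NFASymbol A)) :
    parse (m.symbol :: x) = ([], (m, (parse x).1) :: (parse x).2) := by
  cases m <;> rfl

theorem parse_bits (w : List Bool) (x : List (NFASymbol A)) :
    parse (w.map .bit ++ x) = (w ++ (parse x).1, (parse x).2) := by
  induction w with
  | nil => rfl
  | cons b w ih => simp [parse, ih]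

theorem parse_blocks (bs : List (Marker A × List Bool)) :
    parse (bs.flatMap blockWord) = ([], bs) := by
  induction bs with
  | nil => rfl
  | cons b bs ih => simp [blockWord, parse_symbol, parse_bits, ih]

/-- Holds for arbitrary words, so malformed inputs can also be handled block by block; their leading
bits form the block of the left endmarker. -/
theorem eq_parse (x : List (NFASymbol A)) :
    x = (parse x).1.map .bit ++ (parse x).2.flatMap blockWord := by
  induction x with
  | nil => rfl
  | cons i x ih => cases i <;> simp [parse, blockWord, symbol, ← ih]

end Marker

namespace NFADescription

variable {A : Type}

/-- The blocks of an edge. -/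
def edgeBlocks (t : List Bool × Option A × List Bool) : List (Marker A × List Bool) :=
  [(.edge, t.1), (.label t.2.1, t.2.2)]

/-- The encoding as a sequence of blocks. -/
def blocks (𝒜 : NFADescription A) : List (Marker A × List Bool) :=
  (.init, 𝒜.init) :: (𝒜.states.map (Prod.mk .state) ++ 𝒜.final.map (Prod.mk .final) ++
    𝒜.trans.flatMap edgeBlocks)

theorem encode_eq_blocks (𝒜 : NFADescription A) :
    𝒜.encode = 𝒜.blocks.flatMap Marker.blockWord := by
  simp [encode, blocks, edgeBlocks, Marker.blockWord, Marker.symbol, List.flatMap_map,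
    List.flatMap_assoc]

/-- The description that a sequence of blocks stands for. -/
def ofBlocks : List (Marker A × List Bool) → NFADescription A
  | [] => ⟨[], [], [], []⟩
  | (.init, p) :: bs => { ofBlocks bs with init := p }
  | (.state, p) :: bs => { ofBlocks bs with states := p :: (ofBlocks bs).states }
  | (.final, p) :: bs => { ofBlocks bs with final := p :: (ofBlocks bs).final }
  | (.edge, p) :: (.label a, q) :: bs =>
    { ofBlocks bs with trans := (p, a, q) :: (ofBlocks bs).trans }
  | (.edge, _) :: bs => ofBlocks bs
  | (.label _, _) :: bs => ofBlocks bs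

theorem ofBlocks_blocks (𝒜 : NFADescription A) : ofBlocks 𝒜.blocks = 𝒜 := by
  obtain ⟨init, states, final, trans⟩ := 𝒜
  -- `ofBlocks` peels blocks from the left, so the segments are recovered from the last one
  -- backwards.
  have h₁ : ofBlocks (trans.flatMap edgeBlocks) = ⟨[], [], [], trans⟩ := by
    induction trans with
    | nil => rfl
    | cons t trans ih => simp [edgeBlocks, ofBlocks, ih]
  have h₂ : ofBlocks (final.map (Prod.mk .final) ++ trans.flatMap edgeBlocks) =
      ⟨[], [], final, trans⟩ := by
    induction final with
    | nil => exact h₁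
    | cons p final ih => simp [ofBlocks, ih]
  have h₃ : ofBlocks (states.map (Prod.mk .state) ++ (final.map (Prod.mk .final) ++
      trans.flatMap edgeBlocks)) = ⟨[], states, final, trans⟩ := by
    induction states with
    | nil => exact h₂
    | cons p states ih => simp [ofBlocks, ih]
  simp [blocks, ofBlocks, h₃]

theorem encode_injective : Function.Injective (encode (A := A)) := by
  intro 𝒜 ℬ h
  rw [encode_eq_blocks, encode_eq_blocks] at h
  have h' := congrArg Marker.parse h
  rw [Marker.parse_blocks, Marker.parse_blocks, Prod.mk.injEq] at h'
  rw [← ofBlocks_blocks 𝒜, h'.2, ofBlocks_blocks]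

/-- An encoding is nonempty and starts with `.init`, never with a bit. -/
theorem encode_ne_bits_append (𝒜 : NFADescription A) {w : List Bool} {y : List (NFASymbol A)}
    (h : y = [] ∨ w ≠ []) : w.map .bit ++ y ≠ 𝒜.encode := by
  rcases w with _ | ⟨b, w⟩ <;> simp_all [encode]

end NFADescription

/-! ### Recognition of encodings -/

/-- The part of an encoding that was read last. -/
inductive Stage
  | start
  | states
  | final
  | source
  | edge
  | error

namespace Stage

variable {A : Type}

instance : Finite Stage :=
  Finite.of_surjective (fun i : Fin 6 => match i with
    | 0 => .start
    | 1 => .states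
    | 2 => .final
    | 3 => .source
    | 4 => .edge
    | 5 => .error) fun p => by
      cases p
      exacts [⟨0, rfl⟩, ⟨1, rfl⟩, ⟨2, rfl⟩, ⟨3, rfl⟩, ⟨4, rfl⟩, ⟨5, rfl⟩]

/-- The stage after a further marker. -/
def next : Stage → Marker A → Stage
  | .start, .init => .states
  | .states, .state => .states
  | .states, .final => .final
  | .states, .edge => .source
  | .final, .final => .final
  | .final, .edge => .source
  | .source, .label _ => .edge
  | .edge, .edge => .source
  | _, _ => .error

/-- An encoding may end at this stage. -/
def accepting : Stage → Bool
  | .states => true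
  | .final => true
  | .edge => true
  | _ => false

/-- The stage after a sequence of blocks. -/
def run (s : Stage) (bs : List (Marker A × List Bool)) : Stage :=
  bs.foldl (fun s b => s.next b.1) s

theorem run_cons (s : Stage) (b : Marker A × List Bool) (bs : List (Marker A × List Bool)) :
    s.run (b :: bs) = (s.next b.1).run bs :=
  rfl

theorem run_error (bs : List (Marker A × List Bool)) : error.run bs = error := by
  induction bs with
  | nil => rfl
  | cons b bs ih => exact ih

open NFADescription

theorem accepting_edges (trans : List (List Bool × Option A × List Bool)) {s : Stage}
    (hs : s = states ∨ s = final ∨ s = edge) :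
    (s.run (trans.flatMap edgeBlocks)).accepting := by
  induction trans generalizing s with
  | nil => rcases hs with rfl | rfl | rfl <;> rfl
  | cons t trans ih =>
    rcases hs with rfl | rfl | rfl <;> exact ih (Or.inr (Or.inr rfl))

theorem accepting_blocks (𝒜 : NFADescription A) : (start.run 𝒜.blocks).accepting := by
  obtain ⟨init, sts, fin, trans⟩ := 𝒜
  have h₂ : ∀ s : Stage, s = states ∨ s = final →
      (s.run (fin.map (Prod.mk .final) ++ trans.flatMap edgeBlocks)).accepting := by
    induction fin with
    | nil =>
      rintro s (rfl | rfl)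
      · exact accepting_edges trans (Or.inl rfl)
      · exact accepting_edges trans (Or.inr (Or.inl rfl))
    | cons p fin ih => rintro s (rfl | rfl) <;> exact ih _ (Or.inr rfl)
  have h₃ : (states.run (sts.map (Prod.mk .state) ++ (fin.map (Prod.mk .final) ++
      trans.flatMap edgeBlocks))).accepting := by
    induction sts with
    | nil => exact h₂ _ (Or.inl rfl)
    | cons p sts ih => exact ih
  rw [blocks, run_cons, List.append_assoc]
  exact h₃

theorem exists_edges : ∀ {bs : List (Marker A × List Bool)}, (edge.run bs).accepting →
    ∃ trans : List (List Bool × Option A × List Bool), bs = trans.flatMap edgeBlocks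
  | [], _ => ⟨[], rfl⟩
  | [(.edge, _)], h => by cases h
  | (.edge, p) :: (.label a, q) :: bs, h => by
    obtain ⟨trans, rfl⟩ := exists_edges (bs := bs) h
    exact ⟨(p, a, q) :: trans, rfl⟩
  | (.edge, _) :: (.init, _) :: bs, h | (.edge, _) :: (.state, _) :: bs, h
  | (.edge, _) :: (.final, _) :: bs, h | (.edge, _) :: (.edge, _) :: bs, h
  | (.init, _) :: bs, h | (.state, _) :: bs, h | (.final, _) :: bs, h
  | (.label _, _) :: bs, h => by
    have h' : (error.run bs).accepting := h
    rw [run_error] at h'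
    cases h'

theorem exists_final : ∀ {bs : List (Marker A × List Bool)}, (final.run bs).accepting →
    ∃ (fin : List (List Bool)) (trans : List (List Bool × Option A × List Bool)),
      bs = fin.map (Prod.mk .final) ++ trans.flatMap edgeBlocks
  | [], _ => ⟨[], [], rfl⟩
  | (.final, p) :: bs, h => by
    obtain ⟨fin, trans, rfl⟩ := exists_final (bs := bs) h
    exact ⟨p :: fin, trans, rfl⟩
  | (.edge, p) :: bs, h => by
    obtain ⟨trans, h⟩ := exists_edges (bs := (.edge, p) :: bs) h
    exact ⟨[], trans, h⟩
  | (.init, _) :: bs, h | (.state, _) :: bs, h | (.label _, _) :: bs, h => by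
    have h' : (error.run bs).accepting := h
    rw [run_error] at h'
    cases h'

theorem exists_states : ∀ {bs : List (Marker A × List Bool)}, (states.run bs).accepting →
    ∃ (sts fin : List (List Bool)) (trans : List (List Bool × Option A × List Bool)),
      bs = sts.map (Prod.mk .state) ++ (fin.map (Prod.mk .final) ++ trans.flatMap edgeBlocks)
  | [], _ => ⟨[], [], [], rfl⟩
  | (.state, p) :: bs, h => by
    obtain ⟨sts, fin, trans, rfl⟩ := exists_states (bs := bs) h
    exact ⟨p :: sts, fin, trans, rfl⟩
  | (.final, p) :: bs, h => by
    obtain ⟨fin, trans, h⟩ := exists_final (bs := (.final, p) :: bs) h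
    exact ⟨[], fin, trans, h⟩
  | (.edge, p) :: bs, h => by
    obtain ⟨trans, h⟩ := exists_edges (bs := (.edge, p) :: bs) h
    exact ⟨[], [], trans, h⟩
  | (.init, _) :: bs, h | (.label _, _) :: bs, h => by
    have h' : (error.run bs).accepting := h
    rw [run_error] at h'
    cases h'

/-- Converse of `accepting_blocks`: the markers of an encoding form the regular language `init
state* final* (edge label)*`, which the stages recognize. Any deviation leads to the absorbing stage
`error`. -/
theorem exists_blocks : ∀ {bs : List (Marker A × List Bool)}, (start.run bs).accepting →
    ∃ 𝒜 : NFADescription A, bs = 𝒜.blocks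
  | [], h => by cases h
  | (.init, p) :: bs, h => by
    obtain ⟨sts, fin, trans, rfl⟩ := exists_states (bs := bs) h
    exact ⟨⟨p, sts, fin, trans⟩, by simp [blocks]⟩
  | (.state, _) :: bs, h | (.final, _) :: bs, h | (.edge, _) :: bs, h
  | (.label _, _) :: bs, h => by
    have h' : (error.run bs).accepting := h
    rw [run_error] at h'
    cases h'

end Stage

/-! ### Programs that check for an encoding before they rewrite it -/

namespace Rewriting

variable {A B : Type}

instance [Finite A] : Finite (NFASymbol A) :=
  Finite.of_surjective (fun i : Bool ⊕ Option A ⊕ Fin 4 => match i with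
    | .inl b => .bit b
    | .inr (.inl a) => .label a
    | .inr (.inr 0) => .init
    | .inr (.inr 1) => .state
    | .inr (.inr 2) => .final
    | .inr (.inr 3) => .edge) fun i => by
      cases i with
      | bit b => exact ⟨.inl b, rfl⟩
      | label a => exact ⟨.inr (.inl a), rfl⟩
      | init => exact ⟨.inr (.inr 0), rfl⟩
      | state => exact ⟨.inr (.inr 1), rfl⟩
      | final => exact ⟨.inr (.inr 2), rfl⟩
      | edge => exact ⟨.inr (.inr 3), rfl⟩

/-- A rewriting rule: what to write at a block with a given marker; `none` stands for the binary
word of the block. -/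
abbrev Rule (A B : Type) : Type := Marker A → List (Option (NFASymbol B))

/-- The result of the application of a rule to every block. -/
def Rule.apply (r : Rule A B) (bs : List (Marker A × List Bool)) : List (NFASymbol B) :=
  bs.flatMap fun b => SweepProgram.expand (r b.1) (b.2.map .bit)

/-- The marker in a cell of the input. -/
def cellMarker : InputCell (NFASymbol A) → Option (Marker A)
  | .letter .init => some .init
  | .letter .state => some .state
  | .letter .final => some .final
  | .letter .edge => some .edge
  | .letter (.label a) => some (.label a)
  | _ => none

theorem cellMarker_symbol (m : Marker A) : cellMarker (.letter m.symbol) = some m := by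
  cases m <;> rfl

/-- The lists of rules that remain to be applied after some of `rs` have been. -/
abbrev Remaining (rs : List (Rule A B)) : Type := {l : List (Rule A B) // l <:+ rs}

instance (rs : List (Rule A B)) : Finite (Remaining rs) := by
  refine (rs.tails.finite_toSet.subset (t := {l | l <:+ rs}) fun l h => ?_).to_subtype
  exact (List.mem_tails _ _).2 h

/-- The program that checks in a first sweep whether the input is an encoding and then applies
the rules `rs`, one in each sweep. -/
def program (rs : List (Rule A B)) : SweepProgram (NFASymbol A) (NFASymbol B) where
  copy
    | .bit b => some (.bit b)
    | _ => none
  S := Stage ⊕ Remaining rs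
  start := .inl .start
  act
    | .inl _, .leftEnd => [none]
    | .inr ⟨r :: _, _⟩, c => (cellMarker c).elim [] r
    | _, _ => []
  next
    | .inl s, c => .inl ((cellMarker c).elim s s.next)
    | .inr l, _ => .inr l
  again
    | .inl s => if s.accepting then some (.inr ⟨rs, List.suffix_rfl⟩) else none
    | .inr ⟨_ :: l, h⟩ => some (.inr ⟨l, (List.suffix_cons _ _).trans h⟩)
    | .inr ⟨[], _⟩ => none

open SweepProgram

/-- The block of the input for a block of an encoding. -/
def inputBlock (b : Marker A × List Bool) : Block (NFASymbol A) :=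
  (.letter b.1.symbol, b.2.map .bit)

/-- The blocks of the input for leading bits and blocks of an encoding. -/
def inputBlocks (w : List Bool) (bs : List (Marker A × List Bool)) : List (Block (NFASymbol A)) :=
  (.leftEnd, w.map .bit) :: bs.map inputBlock

variable {rs : List (Rule A B)}

theorem isBlock_of_mem {w : List Bool} {bs : List (Marker A × List Bool)}
    {b : Block (NFASymbol A)} (h : b ∈ inputBlocks w bs) : (program rs).IsBlock b := by
  have hbit : ∀ w : List Bool, ∀ i ∈ w.map NFASymbol.bit, ((program rs).copy i).isSome := by
    rintro w i hi
    obtain ⟨b, -, rfl⟩ := List.mem_map.1 hi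
    rfl
  rcases List.mem_cons.1 h with rfl | h
  · exact ⟨rfl, nofun, hbit _⟩
  · obtain ⟨⟨m, w⟩, -, rfl⟩ := List.mem_map.1 h
    exact ⟨by cases m <;> rfl, nofun, hbit _⟩

theorem tape_eq (w : List Bool) (bs : List (Marker A × List Bool)) :
    tape (w.map .bit ++ bs.flatMap Marker.blockWord) =
      (inputBlocks w bs).flatMap Block.cells := by
  simp [tape, inputBlocks, inputBlock, Block.cells, Marker.blockWord, List.flatMap_map,
    List.map_flatMap]

theorem filterMap_copy_bits (w : List Bool) :
    (w.map NFASymbol.bit).filterMap (program rs).copy = w.map .bit := by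
  induction w with
  | nil => rfl
  | cons b w ih => exact congrArg _ ih

theorem sweepState_check (s : Stage) (w : List Bool) (bs : List (Marker A × List Bool)) :
    (program rs).sweepState (.inl s) (inputBlocks w bs) = .inl (s.run bs) := by
  have h : (program rs).sweepState (.inl s) (bs.map inputBlock) = .inl (s.run bs) := by
    induction bs generalizing s with
    | nil => rfl
    | cons b bs ih =>
      have := ih (s.next b.1)
      simp only [sweepState] at this
      simp [sweepState, inputBlock, program, cellMarker_symbol, Stage.run_cons] at this ⊢
      exact this
  exact h

/-- The checking sweep writes only the leading bits of the input. For an encoding there are none;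
otherwise they spoil the output. -/
theorem sweepOutput_check (s : Stage) (w : List Bool) (bs : List (Marker A × List Bool)) :
    (program rs).sweepOutput (.inl s) (inputBlocks w bs) = w.map .bit := by
  have h : ∀ s, (program rs).sweepOutput (.inl s) (bs.map inputBlock) = [] := by
    induction bs with
    | nil => exact fun _ => rfl
    | cons b bs ih => exact fun s => ih _
  have h' : (program rs).sweepOutput (.inl s) (inputBlocks w bs) =
      expand [none] ((w.map NFASymbol.bit).filterMap (program rs).copy) ++
        (program rs).sweepOutput (.inl s) (bs.map inputBlock) := rfl
  rw [h', h, filterMap_copy_bits]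
  simp [expand]

theorem sweepState_rules (l : Remaining rs) (bs : List (Block (NFASymbol A))) :
    (program rs).sweepState (.inr l) bs = .inr l := by
  induction bs with
  | nil => rfl
  | cons b bs ih => exact ih

theorem sweepOutput_rules_cons (r : Rule A B) (l : List (Rule A B)) (h : r :: l <:+ rs)
    (w : List Bool) (bs : List (Marker A × List Bool)) :
    (program rs).sweepOutput (.inr ⟨r :: l, h⟩) (inputBlocks w bs) = r.apply bs := by
  have h₁ : (program rs).sweepOutput (.inr ⟨r :: l, h⟩) (bs.map inputBlock) = r.apply bs := by
    induction bs with
    | nil => rfl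
    | cons b bs ih =>
      have h₂ : (program rs).sweepOutput (.inr ⟨r :: l, h⟩) ((b :: bs).map inputBlock) =
        expand ((cellMarker (.letter b.1.symbol)).elim [] r)
          ((b.2.map NFASymbol.bit).filterMap (program rs).copy) ++
        (program rs).sweepOutput (.inr ⟨r :: l, h⟩) (bs.map inputBlock) := rfl
      rw [h₂, ih, filterMap_copy_bits, cellMarker_symbol]
      rfl
  exact h₁

theorem sweepOutput_rules_nil (h : [] <:+ rs) (bs : List (Block (NFASymbol A))) :
    (program rs).sweepOutput (.inr ⟨[], h⟩) bs = [] := by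
  induction bs with
  | nil => rfl
  | cons b bs ih => exact ih

theorem run_rules (l : List (Rule A B)) (h : l <:+ rs) (w : List Bool)
    (bs : List (Marker A × List Bool)) :
    (program rs).Run (inputBlocks w bs) (.inr ⟨l, h⟩) (l.flatMap fun r => r.apply bs) := by
  induction l with
  | nil =>
    have := Run.halt (P := program rs) (s := .inr ⟨[], h⟩) (bs := inputBlocks w bs)
      (by rw [sweepState_rules]; rfl)
    rwa [sweepOutput_rules_nil] at this
  | cons r l ih =>
    have := Run.again (P := program rs) (s := .inr ⟨r :: l, h⟩) (bs := inputBlocks w bs)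
      (by rw [sweepState_rules]; rfl) (ih ((List.suffix_cons _ _).trans h))
    rwa [sweepOutput_rules_cons] at this

theorem outputs_of_accepting [Finite A] {w : List Bool} {bs : List (Marker A × List Bool)}
    (h : (Stage.start.run bs).accepting) :
    (program rs).toTM.Outputs (w.map .bit ++ bs.flatMap Marker.blockWord)
      (w.map .bit ++ rs.flatMap fun r => r.apply bs) := by
  refine Run.outputs ?_ (tape_eq w bs) fun b hb => isBlock_of_mem hb
  have := Run.again (P := program rs) (s := .inl .start) (bs := inputBlocks w bs)
    (by rw [sweepState_check]; simp only [program, h, if_true])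
    (run_rules rs List.suffix_rfl w bs)
  rwa [sweepOutput_check] at this

theorem outputs_of_not_accepting [Finite A] {w : List Bool} {bs : List (Marker A × List Bool)}
    (h : ¬ (Stage.start.run bs).accepting) :
    (program rs).toTM.Outputs (w.map .bit ++ bs.flatMap Marker.blockWord) (w.map .bit) := by
  refine Run.outputs ?_ (tape_eq w bs) fun b hb => isBlock_of_mem hb
  have := Run.halt (P := program rs) (s := .inl .start) (bs := inputBlocks w bs)
    (by rw [sweepState_check]; simp only [program, h]; rfl)
  rwa [sweepOutput_check] at this

theorem outputs_encode [Finite A] (𝒜 : NFADescription A) :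
    (program rs).toTM.Outputs 𝒜.encode (rs.flatMap fun r => r.apply 𝒜.blocks) := by
  rw [𝒜.encode_eq_blocks]
  exact outputs_of_accepting (w := []) (Stage.accepting_blocks 𝒜)

/-- If the markers are in order, the input fails to be an encoding only through leading bits, and
these are copied to the front of the output. If the markers are not in order, the machine stops
after the check and the output consists of bits alone. -/
theorem exists_outputs_of_ne_encode [Finite A] {x : List (NFASymbol A)}
    (hx : ∀ 𝒜 : NFADescription A, x ≠ 𝒜.encode) :
    ∃ y, (program rs).toTM.Outputs x y ∧ ∀ ℬ : NFADescription B, y ≠ ℬ.encode := by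
  obtain ⟨w, bs, rfl⟩ : ∃ (w : List Bool) (bs : List (Marker A × List Bool)),
      x = w.map .bit ++ bs.flatMap Marker.blockWord :=
    ⟨_, _, Marker.eq_parse x⟩
  by_cases h : (Stage.start.run bs).accepting
  · refine ⟨_, outputs_of_accepting h, fun ℬ => ℬ.encode_ne_bits_append (Or.inr ?_)⟩
    rintro rfl
    obtain ⟨𝒜, rfl⟩ := Stage.exists_blocks h
    exact hx 𝒜 𝒜.encode_eq_blocks.symm
  · refine ⟨_, outputs_of_not_accepting h, fun ℬ => ?_⟩
    simpa using ℬ.encode_ne_bits_append (w := w) (y := []) (Or.inl rfl)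

end Rewriting

/-! ### The rules for the composition with a transducer -/

namespace RationalTransducer

open Rewriting

variable {A B : Type} (T : RationalTransducer B A)

/-- Write the code of a state. -/
noncomputable def writeCode (q : Option T.Q) : List (Option (NFASymbol B)) :=
  (T.code q).map fun b => some (.bit b)

/-- The rule that writes the initial state. -/
noncomputable def initRule : Rule A B
  | .init => some .init :: (T.writeCode (some T.start) ++ [none])
  | _ => []

/-- The rule that writes the final states which belong to the state `q` of `T`. -/
noncomputable def finalRule (q : T.Q) : Rule A B
  | .final => some .final :: (T.writeCode (some q) ++ [none])
  | _ => []

/-- The rule that writes the edges for a move. -/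
noncomputable def moveRule (t : T.Q × Option B × Option A × T.Q) : Rule A B
  | .edge => some .edge :: (T.writeCode (some t.1) ++ [none])
  | .label l => some (.label t.2.1) :: (T.writeCode (T.moveTarget t l) ++ [none])
  | _ => []

/-- Write the edge for a transition that writes nothing. -/
noncomputable def writeStay (t : T.Q × Option B × T.Q) : List (Option (NFASymbol B)) :=
  some .edge :: (T.writeCode (some t.1) ++
    none :: some (.label t.2.1) :: (T.writeCode (some t.2.2) ++ [none]))

/-- The rule that writes the edges for a transition that writes nothing. -/
noncomputable def stayRule (t : T.Q × Option B × T.Q) : Rule A B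
  | .init => T.writeStay t
  | .label _ => T.writeStay t
  | _ => []

theorem expand_writeCode_append (q : Option T.Q) (l : List (Option (NFASymbol B)))
    (w : List (NFASymbol B)) : SweepProgram.expand (T.writeCode q ++ l) w =
      (T.code q).map .bit ++ SweepProgram.expand l w := by
  simp only [SweepProgram.expand, writeCode, List.flatMap_append, List.flatMap_map]
  rw [List.map_eq_flatMap]

theorem expand_some_cons (o : NFASymbol B) (l : List (Option (NFASymbol B)))
    (w : List (NFASymbol B)) : SweepProgram.expand (some o :: l) w =
      o :: SweepProgram.expand l w :=
  rfl

theorem expand_none_cons (l : List (Option (NFASymbol B))) (w : List (NFASymbol B)) :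
    SweepProgram.expand (none :: l) w = w ++ SweepProgram.expand l w :=
  rfl

theorem expand_nil (w : List (NFASymbol B)) : SweepProgram.expand [] w = [] :=
  rfl

/-- Cuts the result of a sweep into the four segments of an encoding, so that a rule can be
evaluated segment by segment. -/
theorem apply_blocks (r : Rule A B) (𝒜 : NFADescription A) : r.apply 𝒜.blocks =
    SweepProgram.expand (r .init) (𝒜.init.map .bit) ++
    (𝒜.states.flatMap fun p => SweepProgram.expand (r .state) (p.map .bit)) ++
    (𝒜.final.flatMap fun p => SweepProgram.expand (r .final) (p.map .bit)) ++
    𝒜.trans.flatMap fun t => SweepProgram.expand (r .edge) (t.1.map .bit) ++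
      SweepProgram.expand (r (.label t.2.1)) (t.2.2.map .bit) := by
  simp [Rule.apply, NFADescription.blocks, NFADescription.edgeBlocks, List.flatMap_map,
    List.flatMap_assoc]

theorem flatMap_const_nil {X Y : Type} (l : List X) : (l.flatMap fun _ => ([] : List Y)) = [] := by
  simp

theorem apply_initRule (𝒜 : NFADescription A) : Rule.apply T.initRule 𝒜.blocks =
    .init :: (T.code (some T.start) ++ 𝒜.init).map .bit := by
  simp only [apply_blocks, initRule, expand_some_cons, expand_none_cons, expand_nil,
    expand_writeCode_append, flatMap_const_nil, List.append_nil, List.map_append]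

theorem apply_finalRule (q : T.Q) (𝒜 : NFADescription A) :
    Rule.apply (T.finalRule q) 𝒜.blocks =
      (𝒜.final.map fun p => T.code (some q) ++ p).flatMap fun p => .final :: p.map .bit := by
  simp only [apply_blocks, finalRule, expand_some_cons, expand_none_cons, expand_nil,
    expand_writeCode_append, flatMap_const_nil, List.append_nil, List.map_append, List.nil_append,
    List.flatMap_map]

theorem apply_moveRule (t : T.Q × Option B × Option A × T.Q) (𝒜 : NFADescription A) :
    Rule.apply (T.moveRule t) 𝒜.blocks =
      (𝒜.trans.map (T.moveEdge t)).flatMap fun e =>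
        .edge :: e.1.map .bit ++ .label e.2.1 :: e.2.2.map .bit := by
  simp only [apply_blocks, moveRule, expand_some_cons, expand_none_cons, expand_nil,
    expand_writeCode_append, flatMap_const_nil, List.append_nil, List.map_append, List.nil_append,
    List.flatMap_map, moveEdge, List.cons_append]

theorem apply_stayRule (t : T.Q × Option B × T.Q) (𝒜 : NFADescription A) :
    Rule.apply (T.stayRule t) 𝒜.blocks =
      ((𝒜.init :: 𝒜.trans.map fun e => e.2.2).map (T.stayEdge t)).flatMap fun e =>
        .edge :: e.1.map .bit ++ .label e.2.1 :: e.2.2.map .bit := by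
  simp only [apply_blocks, stayRule, writeStay, expand_some_cons, expand_none_cons, expand_nil,
    expand_writeCode_append, flatMap_const_nil, List.append_nil, List.map_append, List.nil_append,
    List.flatMap_map, List.map_cons, List.flatMap_cons, stayEdge, List.cons_append,
    List.append_assoc]

variable [Finite A] [Finite B]

/-- The rules that write the composition of `T` and the automaton in the input. -/
noncomputable def rules : List (Rule A B) :=
  T.initRule :: (T.acceptList.map T.finalRule ++ T.moves.map T.moveRule ++
    T.stays.map T.stayRule)

/-- An equality of words, not just of automata: `compose` lists its final states and edges in the
order in which the sweeps produce them. -/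
theorem flatMap_rules (𝒜 : NFADescription A) :
    (T.rules.flatMap fun r => r.apply 𝒜.blocks) = (T.compose 𝒜).encode := by
  simp only [rules, List.flatMap_cons, List.flatMap_append, List.flatMap_map, apply_initRule,
    apply_finalRule, apply_moveRule, apply_stayRule, NFADescription.encode, compose,
    List.flatMap_nil, List.append_nil, List.flatMap_assoc, List.append_assoc]

/-- Composition with `T` is computable in logarithmic space. -/
theorem exists_logSpaceComputable_compose :
    ∃ f : List (NFASymbol A) → List (NFASymbol B), LogSpaceComputable f ∧
      (∀ 𝒜 : NFADescription A, f 𝒜.encode = (T.compose 𝒜).encode) ∧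
      ∀ x, (∀ 𝒜 : NFADescription A, x ≠ 𝒜.encode) → ∀ ℬ : NFADescription B, f x ≠ ℬ.encode := by
  -- The function is obtained by choosing, for each input, an output of the machine; both cases are
  -- put into one statement so that a single choice covers them.
  have h : ∀ x, ∃ y, (program T.rules).toTM.Outputs x y ∧
      (∀ 𝒜 : NFADescription A, x = 𝒜.encode → y = (T.compose 𝒜).encode) ∧
      ((∀ 𝒜 : NFADescription A, x ≠ 𝒜.encode) → ∀ ℬ : NFADescription B, y ≠ ℬ.encode) := by
    intro x
    by_cases hx : ∃ 𝒜 : NFADescription A, x = 𝒜.encode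
    · obtain ⟨𝒜, rfl⟩ := hx
      refine ⟨(T.compose 𝒜).encode, ?_, fun 𝒜' h => ?_, fun h => absurd rfl (h 𝒜)⟩
      · rw [← flatMap_rules]
        exact outputs_encode 𝒜
      · rw [NFADescription.encode_injective h]
    · have hx' : ∀ 𝒜 : NFADescription A, x ≠ 𝒜.encode := fun 𝒜 h => hx ⟨𝒜, h⟩
      obtain ⟨y, hy, hy'⟩ := exists_outputs_of_ne_encode (rs := T.rules) hx'
      exact ⟨y, hy, fun 𝒜 h => absurd h (hx' 𝒜), fun _ => hy'⟩
  choose f hf hf₁ hf₂ using h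
  exact ⟨f, SweepProgram.logSpaceComputable _ hf, fun 𝒜 => hf₁ _ 𝒜 rfl, hf₂⟩

end RationalTransducer

/-- Injectivity of the encoding is what turns membership of a word in `NRR F` into a property of the
automaton. -/
theorem mem_NRR_encode {A : Type} {F : Language A} {𝒜 : NFADescription A} :
    𝒜.encode ∈ NRR F ↔ ∃ u, u ∈ 𝒜.language ∧ u ∈ F := by
  constructor
  · rintro ⟨ℬ, h, hu⟩
    rwa [NFADescription.encode_injective h]
  · exact fun h => ⟨𝒜, rfl, h⟩

theorem RationalTransducer.exists_reduction {A B : Type} [Finite A] [Finite B] {F₁ : Language A}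
    {F₂ : Language B} (T : RationalTransducer B A) (hT : F₁ = T.image F₂) :
    ∃ f : List (NFASymbol A) → List (NFASymbol B),
      IsLogSpaceReduction (NRR F₁) (NRR F₂) f ∧
      ∀ 𝒜 : NFADescription A, ∃ ℬ : NFADescription B, f 𝒜.encode = ℬ.encode ∧
        ∀ w : List B, w ∈ ℬ.language ↔ ∃ y ∈ 𝒜.language, T.Realizes w y := by
  obtain ⟨f, hf, hf₁, hf₂⟩ := T.exists_logSpaceComputable_compose
  refine ⟨f, ⟨hf, fun x => ?_⟩, fun 𝒜 => ⟨T.compose 𝒜, hf₁ 𝒜, fun w => mem_language_compose⟩⟩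
  by_cases hx : ∃ 𝒜 : NFADescription A, x = 𝒜.encode
  · obtain ⟨𝒜, rfl⟩ := hx
    rw [hf₁, mem_NRR_encode, mem_NRR_encode, hT]
    constructor
    · rintro ⟨y, hy, w, hw, h⟩
      exact ⟨w, mem_language_compose.2 ⟨y, hy, h⟩, hw⟩
    · rintro ⟨w, hw, hw₂⟩
      obtain ⟨y, hy, h⟩ := mem_language_compose.1 hw
      exact ⟨y, hy, w, hw₂, h⟩
  · have hx' : ∀ 𝒜 : NFADescription A, x ≠ 𝒜.encode := fun 𝒜 h => hx ⟨𝒜, h⟩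
    -- A word that is no encoding lies outside `NRR F₁`, and its image lies outside `NRR F₂` for the
    -- same reason.
    exact ⟨fun ⟨𝒜, h, _⟩ => absurd h (hx' 𝒜), fun ⟨ℬ, h, _⟩ => absurd h (hf₂ x hx' ℬ)⟩

theorem mainTheorem6 {A B : Type} [Finite A] [Finite B] (F₁ : Language A) (F₂ : Language B)
    (h : RatDominated F₁ F₂) :
    LogSpaceReducible (NRR F₁) (NRR F₂) ∧
    (∃ T : RationalTransducer B A, F₁ = T.image F₂) ∧
    ∀ T : RationalTransducer B A, F₁ = T.image F₂ →
      ∃ f : List (NFASymbol A) → List (NFASymbol B),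
        IsLogSpaceReduction (NRR F₁) (NRR F₂) f ∧
        ∀ 𝒜 : NFADescription A, ∃ ℬ : NFADescription B, f 𝒜.encode = ℬ.encode ∧
          ∀ w : List B, w ∈ ℬ.language ↔ ∃ y ∈ 𝒜.language, T.Realizes w y := by
  obtain ⟨T, hT⟩ := h.exists_transducer
  obtain ⟨f, hf, -⟩ := T.exists_reduction hT
  exact ⟨⟨f, hf⟩, ⟨T, hT⟩, fun T hT => T.exists_reduction hT⟩
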